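/- Work in the language $L_2$ of second-order arithmetic. $\mathsf{RCA}_0$ is the formal system consisting of the usual basic axioms for $0,1,+,\cdot,<$, induction for $\Sigma^0_1$ formulas, and $\Delta^0_1$ comprehension. $\mathsf{ACA}$ is the arithmetical comprehension scheme: $\exists X\,\forall x\,(x\in X\leftrightarrow\varphi(x))$ for every arithmetical formula $\varphi$ (with number and set parameters) in which $X$ is not free. For $m\ge 1$ and $k\ge 2$, let $[\mathbb{N}]^m$ be the set of $m$-element subsets of $\mathbb{N}$, identified with increasing $m$-tuples, and let $\mathsf{TS}^m_k$ be the statement of $L_2$: for every $f\colon[\mathbb{N}]^m\to\{0,\dots,k-1\}$ there is an infinite set $H\subseteq\mathbb{N}$ that is thin for $f$, i.e. there is a color $c<k$ with $f(\vec x)\ne c$ for all $\vec x\in[H]^m$. **Proposition.** For each (standard) $n\ge 1$, $$\mathsf{RCA}_0\vdash \mathsf{TS}^{n+2}_{2^n}\rightarrow\mathsf{ACA},$$ that is, $\mathsf{RCA}_0$ proves that $\mathsf{TS}^{n+2}_{2^n}$ implies every instance of $\mathsf{ACA}$. -/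

import Mathlib

/-! # Second-order arithmetic, the system `RCA₀`, the thin set principles and `ACA`

Formulas of the two-sorted language `L₂` of second-order arithmetic are written with de Bruijn
indices, separately for the two sorts: the number variable `i` refers to the `i`-th enclosing
number quantifier, counted from the inside, and likewise for set variables and set quantifiers. -/

namespace SecondOrderArith

/-- Numerical terms of `L₂`. -/
inductive Term : Type
  | var : ℕ → Term
  | zero : Term
  | one : Term
  | add : Term → Term → Term
  | mul : Term → Term → Term

namespace Term

/-- Simultaneous substitution of terms for number variables. -/
def subst (σ : ℕ → Term) : Term → Term
  | var i => σ i
  | zero => zero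
  | one => one
  | add s t => add (s.subst σ) (t.subst σ)
  | mul s t => mul (s.subst σ) (t.subst σ)

/-- Raise all number variables by one (move the term below one more number quantifier). -/
def shift (t : Term) : Term := t.subst fun i => var (i + 1)

/-- The numeral of a standard natural number. -/
def numeral : ℕ → Term
  | 0 => zero
  | k + 1 => add (numeral k) one

/-- The code `(s + t)² + s` of the ordered pair `(s, t)`. -/
def pair (s t : Term) : Term := add (mul (add s t) (add s t)) s

/-- The code of the tuple `(x 0, …, x (m - 1))`, for a standard length `m`, as an iterated pair. -/
def tuple (x : ℕ → Term) : ℕ → Term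
  | 0 => zero
  | m + 1 => pair (tuple x m) (x m)

end Term

open Term

/-- Push a substitution for number variables below a number quantifier. -/
def liftSubst (σ : ℕ → Term) : ℕ → Term
  | 0 => var 0
  | i + 1 => (σ i).shift

/-- Push a renaming of set variables below a set quantifier. -/
def liftRen (ρ : ℕ → ℕ) : ℕ → ℕ
  | 0 => 0
  | i + 1 => ρ i + 1

/-- The substitution that replaces the number variable `0` by `t` and lowers the others by one. -/
def instTerm (t : Term) : ℕ → Term
  | 0 => t
  | i + 1 => var i

/-- The renaming that replaces the set variable `0` by `j` and lowers the others by one. -/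
def instSet (j : ℕ) : ℕ → ℕ
  | 0 => j
  | i + 1 => i

/-- Formulas of `L₂`. The set terms are the set variables. The remaining connectives and the
existential quantifiers are the usual classical abbreviations. -/
inductive Form : Type
  | eq : Term → Term → Form
  | lt : Term → Term → Form
  /-- `mem t X` is the formula `t ∈ X`. -/
  | mem : Term → ℕ → Form
  | falsum : Form
  | imp : Form → Form → Form
  /-- Universal quantification over numbers. -/
  | allN : Form → Form
  /-- Universal quantification over sets. -/
  | allS : Form → Form

namespace Form

def neg (φ : Form) : Form := imp φ falsum
def and (φ ψ : Form) : Form := neg (imp φ (neg ψ))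
def or (φ ψ : Form) : Form := imp (neg φ) ψ
def iff (φ ψ : Form) : Form := and (imp φ ψ) (imp ψ φ)
def exN (φ : Form) : Form := neg (allN (neg φ))
def exS (φ : Form) : Form := neg (allS (neg φ))

/-- Simultaneous (capture-avoiding) substitution of terms for number variables. -/
def substN : (ℕ → Term) → Form → Form
  | σ, eq s t => eq (s.subst σ) (t.subst σ)
  | σ, lt s t => lt (s.subst σ) (t.subst σ)
  | σ, mem t X => mem (t.subst σ) X
  | _, falsum => falsum
  | σ, imp φ ψ => imp (substN σ φ) (substN σ ψ)
  | σ, allN φ => allN (substN (liftSubst σ) φ)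
  | σ, allS φ => allS (substN σ φ)

/-- Simultaneous (capture-avoiding) renaming of set variables. -/
def renS : (ℕ → ℕ) → Form → Form
  | _, eq s t => eq s t
  | _, lt s t => lt s t
  | ρ, mem t X => mem t (ρ X)
  | _, falsum => falsum
  | ρ, imp φ ψ => imp (renS ρ φ) (renS ρ ψ)
  | ρ, allN φ => allN (renS ρ φ)
  | ρ, allS φ => allS (renS (liftRen ρ) φ)

/-- Raise all free number variables by one. -/
def shiftN (φ : Form) : Form := φ.substN fun i => var (i + 1)

/-- Raise all free set variables by one. -/
def shiftS (φ : Form) : Form := φ.renS fun i => i + 1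

/-- `φ(t)`, where `φ` is regarded as a formula `φ(n)` in its number variable `n` of index `0`. -/
def instN (t : Term) (φ : Form) : Form := φ.substN (instTerm t)

/-- `φ(X)`, where `φ` is regarded as a formula in its set variable of index `0` and `X` is the
set variable `j`. -/
def instS (j : ℕ) (φ : Form) : Form := φ.renS (instSet j)

/-- `φ(n + 1)`, where `n` is the number variable of index `0`. -/
def instSucc (φ : Form) : Form :=
  φ.substN fun
    | 0 => add (var 0) one
    | i + 1 => var (i + 1)

/-- The bounded quantification `∀ n < t, φ(n)`, where the bound `t` does not contain `n`. -/
def ballN (t : Term) (φ : Form) : Form := allN (imp (lt (var 0) t.shift) φ)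

/-- A block of `m` universal number quantifiers; below it the variables have indices `0 … m-1`. -/
def allNs : ℕ → Form → Form
  | 0, φ => φ
  | m + 1, φ => allNs m (allN φ)

/-- A block of `m` existential number quantifiers. -/
def exNs : ℕ → Form → Form
  | 0, φ => φ
  | m + 1, φ => exNs m (exN φ)

/-- The conjunction of `φ 0, …, φ (m - 1)`. -/
def conj (φ : ℕ → Form) : ℕ → Form
  | 0 => imp falsum falsum
  | m + 1 => and (conj φ m) (φ m)

/-- Bounded quantifier formulas, that is, `Σ⁰₀` formulas, with set parameters. (Bounded existential
quantifiers are obtained from bounded universal ones by negation.) -/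
inductive IsBounded : Form → Prop
  | eq (s t : Term) : IsBounded (Form.eq s t)
  | lt (s t : Term) : IsBounded (Form.lt s t)
  | mem (t : Term) (X : ℕ) : IsBounded (Form.mem t X)
  | falsum : IsBounded Form.falsum
  | imp {φ ψ : Form} : IsBounded φ → IsBounded ψ → IsBounded (Form.imp φ ψ)
  | ballN (t : Term) {φ : Form} : IsBounded φ → IsBounded (Form.ballN t φ)

/-- `Σ⁰₁` formulas `∃ n, θ` with `θ` a bounded quantifier formula. -/
def IsSigma1 (φ : Form) : Prop := ∃ θ : Form, IsBounded θ ∧ φ = exN θ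

/-- `Π⁰₁` formulas `∀ n, θ` with `θ` a bounded quantifier formula. -/
def IsPi1 (φ : Form) : Prop := ∃ θ : Form, IsBounded θ ∧ φ = allN θ

/-- Arithmetical formulas: no set quantifiers (free set variables are allowed). -/
inductive IsArithmetical : Form → Prop
  | eq (s t : Term) : IsArithmetical (Form.eq s t)
  | lt (s t : Term) : IsArithmetical (Form.lt s t)
  | mem (t : Term) (X : ℕ) : IsArithmetical (Form.mem t X)
  | falsum : IsArithmetical Form.falsum
  | imp {φ ψ : Form} : IsArithmetical φ → IsArithmetical ψ → IsArithmetical (Form.imp φ ψ)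
  | allN {φ : Form} : IsArithmetical φ → IsArithmetical (Form.allN φ)

end Form

open Form

/-- `Derivable T Γ φ`: the formula `φ` is derivable from the axioms in `T` and the assumptions in
`Γ` in natural deduction for classical two-sorted first-order logic with equality (between
numbers). Free variables in axioms are understood as universally quantified, free variables in
assumptions as parameters. -/
inductive Derivable (T : Set Form) : List Form → Form → Prop
  | ax {Γ : List Form} {φ : Form} : φ ∈ T → Derivable T Γ φ
  | hyp {Γ : List Form} {φ : Form} : φ ∈ Γ → Derivable T Γ φ
  | impI {Γ : List Form} {φ ψ : Form} : Derivable T (φ :: Γ) ψ → Derivable T Γ (imp φ ψ)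
  | impE {Γ : List Form} {φ ψ : Form} :
      Derivable T Γ (imp φ ψ) → Derivable T Γ φ → Derivable T Γ ψ
  | raa {Γ : List Form} {φ : Form} : Derivable T (neg φ :: Γ) falsum → Derivable T Γ φ
  | allNI {Γ : List Form} {φ : Form} :
      Derivable T (Γ.map shiftN) φ → Derivable T Γ (allN φ)
  | allNE {Γ : List Form} {φ : Form} (t : Term) :
      Derivable T Γ (allN φ) → Derivable T Γ (instN t φ)
  | allSI {Γ : List Form} {φ : Form} :
      Derivable T (Γ.map shiftS) φ → Derivable T Γ (allS φ)
  | allSE {Γ : List Form} {φ : Form} (j : ℕ) :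
      Derivable T Γ (allS φ) → Derivable T Γ (instS j φ)
  | eqRefl {Γ : List Form} (t : Term) : Derivable T Γ (eq t t)
  | eqSubst {Γ : List Form} {s t : Term} (φ : Form) :
      Derivable T Γ (eq s t) → Derivable T Γ (instN s φ) → Derivable T Γ (instN t φ)

/-- `T ⊢ φ`. -/
def Proves (T : Set Form) (φ : Form) : Prop := Derivable T [] φ

/-- The basic axioms on `0`, `1`, `+`, `·`, `<`, with `m` the variable `0` and `n` the
variable `1`. -/
inductive BasicAxiom : Form → Prop
  | succ_ne_zero : BasicAxiom (neg (eq (add (var 0) one) zero))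
  | succ_inj : BasicAxiom
      (imp (eq (add (var 0) one) (add (var 1) one)) (eq (var 0) (var 1)))
  | add_zero : BasicAxiom (eq (add (var 0) zero) (var 0))
  | add_succ : BasicAxiom
      (eq (add (var 0) (add (var 1) one)) (add (add (var 0) (var 1)) one))
  | mul_zero : BasicAxiom (eq (mul (var 0) zero) zero)
  | mul_succ : BasicAxiom
      (eq (mul (var 0) (add (var 1) one)) (add (mul (var 0) (var 1)) (var 0)))
  | not_lt_zero : BasicAxiom (neg (lt (var 0) zero))
  | lt_succ : BasicAxiom
      (iff (lt (var 0) (add (var 1) one)) (or (lt (var 0) (var 1)) (eq (var 0) (var 1))))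

/-- The induction axiom `φ(0) ∧ ∀ n (φ(n) → φ(n + 1)) → ∀ n φ(n)`. -/
def inductionAxiom (φ : Form) : Form :=
  imp (and (instN zero φ) (allN (imp φ (instSucc φ)))) (allN φ)

/-- The comprehension axiom `∃ X ∀ n (n ∈ X ↔ φ(n))`, where `X` is not free in `φ`. -/
def comprehensionAxiom (φ : Form) : Form :=
  exS (allN (iff (mem (var 0) 0) (shiftS φ)))

/-- The axioms of `RCA₀`: the basic axioms, `Σ⁰₁` induction, and `Δ⁰₁` comprehension
`∀ n (φ(n) ↔ ψ(n)) → ∃ X ∀ n (n ∈ X ↔ φ(n))` for `φ` in `Σ⁰₁` and `ψ` in `Π⁰₁`. -/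
inductive RCA0Axiom : Form → Prop
  | basic {φ : Form} : BasicAxiom φ → RCA0Axiom φ
  | sigma1Induction {φ : Form} : IsSigma1 φ → RCA0Axiom (inductionAxiom φ)
  | delta1Comprehension {φ ψ : Form} : IsSigma1 φ → IsPi1 ψ →
      RCA0Axiom (imp (allN (iff φ ψ)) (comprehensionAxiom φ))

/-- The system `RCA₀`. -/
def RCA0 : Set Form := {φ | RCA0Axiom φ}

/-- `ACA`, the arithmetical comprehension scheme. -/
def ACA : Set Form := {χ | ∃ φ : Form, IsArithmetical φ ∧ χ = comprehensionAxiom φ}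

/-- `x 0 < x 1 < ⋯ < x (m - 1)`. -/
def increasing (x : ℕ → Term) (m : ℕ) : Form := conj (fun i => lt (x i) (x (i + 1))) (m - 1)

/-- "The set `F` is (the graph of) a function `[ℕ]^m → k`", where an element of `[ℕ]^m` is given
as an increasing tuple: every element of `F` is the code of a pair of some tuple in `[ℕ]^m` and
some `c < k`; for every tuple in `[ℕ]^m` there is such a `c`; and it is unique.
Below `∀ x₀ … xₘ₋₁ ∀ c` the variable `c` is `var 0` and `xᵢ` is `var (i + 1)`. -/
def isColoring (m k F : ℕ) : Form :=
  and (allN (imp (mem (var 0) F)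
        (exNs m (exN (and (increasing (fun i => var (i + 1)) m)
          (and (lt (var 0) (numeral k))
            (eq (var (m + 1)) (pair (tuple (fun i => var (i + 1)) m) (var 0)))))))))
    (and (allNs m (imp (increasing var m)
        (exN (and (lt (var 0) (numeral k))
          (mem (pair (tuple (fun i => var (i + 1)) m) (var 0)) F)))))
      (allNs m (allN (allN (imp
        (and (mem (pair (tuple (fun i => var (i + 2)) m) (var 1)) F)
          (mem (pair (tuple (fun i => var (i + 2)) m) (var 0)) F))
        (eq (var 1) (var 0)))))))

/-- "The set `H` is infinite", that is, unbounded: `∀ b ∃ x (b < x ∧ x ∈ H)`. -/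
def isInfinite (H : ℕ) : Form := allN (exN (and (lt (var 1) (var 0)) (mem (var 0) H)))

/-- "The set `H` is thin for the coloring `F : [ℕ]^m → k`": there is a color `c < k` such that
`F(x₀, …, xₘ₋₁) ≠ c` for all `x₀ < ⋯ < xₘ₋₁` in `H`. Below `∃ c ∀ x₀ … xₘ₋₁` the variable `xᵢ`
is `var i` and `c` is `var m`. -/
def isThin (m k F H : ℕ) : Form :=
  exN (and (lt (var 0) (numeral k))
    (allNs m (imp (and (increasing var m) (conj (fun i => mem (var i) H) m))
      (neg (mem (pair (tuple var m) (var m)) F)))))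

/-- The thin set principle `TS^m_k`: every `F : [ℕ]^m → k` has an infinite thin set. -/
def TS (m k : ℕ) : Form :=
  allS (imp (isColoring m k 0) (exS (and (isInfinite 0) (isThin m k 1 0))))

end SecondOrderArith

/-! By the completeness theorem it suffices to work in a countable model of `RCA₀`. There,
arithmetical comprehension follows once every `Σ⁰₁` set `S = {u | ∃ t, (u, t) ∈ X}` exists:
quantifiers can then be absorbed, one at a time, into set parameters (`DefB.sat_of_isArithmetical`).

Let `S_y` consist of the `u` with a witness below `y`. Colour `x₀ < ⋯ < xₙ₊₁` by `n` bits, bit `i`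
telling whether some `u < xᵢ` lies in `S_z` but not in `S_y`, for `y = xᵢ₊₁` and `z = xᵢ₊₂`
(`Change`). There are `2 ^ n` colours, so an infinite thin set `H` omits some pattern `γ` of bits.

For fixed `x < y`, the bit of `x, y, z` is constant for large `z`. Hence one can speak of `y` ending
a chain in `H` whose first `j` bits, the last one taken in the limit over `z`, follow `γ`
(`LimChain`). For `j = 0` such `y` are unbounded because `H` is infinite; for `j = n` there are
none, since a large `z ∈ H` would complete a tuple of the omitted colour. So for some `j` they are
unbounded, while for `j + 1` they are bounded by some `b`. If `γ j` were false, one could take `y`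
ending a limit chain for `j` and then `z ∈ H` so late that `S` has settled below `y`; this `z` would
end a limit chain for `j + 1` beyond `b`. So `γ j` is true, and a chain for `j` ending in `x < z`
with `z > b` certifies that `S` has settled below `x` by stage `z`. Such chains exist with `x`
arbitrarily large, so `S` is `Δ⁰₁` in `H` and `X` (`exists_sigma1_of_not_chain`).

That `S` settles below each `y` needs strong `Σ⁰₁` bounding, which is derived from `Σ⁰₁` induction
by coding finite sets through divisibility (`exists_code`). -/

namespace SecondOrderArith

open Term Form

/-! ### Substitution calculus -/

namespace Term

theorem subst_subst (σ τ : ℕ → Term) (t : Term) :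
    (t.subst σ).subst τ = t.subst fun i => (σ i).subst τ := by
  induction t <;> simp_all [subst]

theorem subst_var (t : Term) : t.subst var = t := by
  induction t <;> simp_all [subst]

theorem subst_shift (σ : ℕ → Term) (t : Term) :
    t.shift.subst (liftSubst σ) = (t.subst σ).shift := by
  simp only [shift, subst_subst]
  rfl

theorem shift_subst_instTerm (s t : Term) : s.shift.subst (instTerm t) = s := by
  simp only [shift, subst_subst]
  exact subst_var s

/-- A strict upper bound for the variables of a term. -/
def bound : Term → ℕ
  | var i => i + 1
  | zero => 0
  | one => 0
  | add s t => max s.bound t.bound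
  | mul s t => max s.bound t.bound

theorem subst_congr {σ τ : ℕ → Term} (t : Term) (h : ∀ i < t.bound, σ i = τ i) :
    t.subst σ = t.subst τ := by
  induction t with
  | var i => exact h i (by simp [bound])
  | zero => rfl
  | one => rfl
  | add s t hs ht | mul s t hs ht =>
    simp only [bound, lt_max_iff] at h
    simp only [subst]
    rw [hs fun i hi => h i (.inl hi), ht fun i hi => h i (.inr hi)]

/-- An injective coding of terms by natural numbers. -/
def encode : Term → ℕ
  | var i => Nat.pair 0 i
  | zero => Nat.pair 1 0
  | one => Nat.pair 2 0
  | add s t => Nat.pair 3 (Nat.pair s.encode t.encode)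
  | mul s t => Nat.pair 4 (Nat.pair s.encode t.encode)

theorem encode_injective : Function.Injective encode := by
  intro s
  induction s <;> intro t h <;> cases t <;> simp [encode, Nat.pair_eq_pair] at h ⊢ <;> grind

instance : Countable Term := encode_injective.countable

end Term

theorem liftSubst_var : liftSubst var = var := by
  funext i
  cases i <;> rfl

theorem liftSubst_comp (σ τ : ℕ → Term) :
    (fun i => (liftSubst σ i).subst (liftSubst τ)) = liftSubst fun i => (σ i).subst τ := by
  funext i
  cases i with
  | zero => rfl
  | succ i => exact subst_shift τ (σ i)

theorem liftRen_id : liftRen id = id := by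
  funext i
  cases i <;> rfl

theorem liftRen_comp (ρ π : ℕ → ℕ) :
    (fun i => liftRen π (liftRen ρ i)) = liftRen fun i => π (ρ i) := by
  funext i
  cases i <;> rfl

namespace Form

theorem substN_var (φ : Form) : φ.substN var = φ := by
  induction φ <;> simp_all [substN, subst_var, liftSubst_var]

theorem renS_id (φ : Form) : φ.renS id = φ := by
  induction φ <;> simp_all [renS, liftRen_id]

theorem substN_substN (σ τ : ℕ → Term) (φ : Form) :
    (φ.substN σ).substN τ = φ.substN fun i => (σ i).subst τ := by
  induction φ generalizing σ τ <;> simp_all [substN, subst_subst, liftSubst_comp]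

theorem renS_renS (ρ π : ℕ → ℕ) (φ : Form) :
    (φ.renS ρ).renS π = φ.renS fun i => π (ρ i) := by
  induction φ generalizing ρ π <;> simp_all [renS, liftRen_comp]

theorem substN_renS (σ : ℕ → Term) (ρ : ℕ → ℕ) (φ : Form) :
    (φ.renS ρ).substN σ = (φ.substN σ).renS ρ := by
  induction φ generalizing σ ρ <;> simp_all [substN, renS]

theorem substN_shiftN (σ : ℕ → Term) (φ : Form) :
    φ.shiftN.substN (liftSubst σ) = (φ.substN σ).shiftN := by
  simp only [shiftN, substN_substN]
  rfl

theorem renS_shiftS (ρ : ℕ → ℕ) (φ : Form) :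
    φ.shiftS.renS (liftRen ρ) = (φ.renS ρ).shiftS := by
  simp only [shiftS, renS_renS]
  rfl

theorem substN_instN (σ : ℕ → Term) (t : Term) (φ : Form) :
    (φ.instN t).substN σ = (φ.substN (liftSubst σ)).instN (t.subst σ) := by
  simp only [instN, substN_substN]
  congr 1
  funext i
  cases i with
  | zero => rfl
  | succ i => exact (shift_subst_instTerm (σ i) _).symm

theorem renS_instS (ρ : ℕ → ℕ) (j : ℕ) (φ : Form) :
    (φ.instS j).renS ρ = (φ.renS (liftRen ρ)).instS (ρ j) := by
  simp only [instS, renS_renS]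
  congr 1
  funext i
  cases i <;> rfl

theorem renS_instN (ρ : ℕ → ℕ) (t : Term) (φ : Form) :
    (φ.instN t).renS ρ = (φ.renS ρ).instN t := (substN_renS _ _ _).symm

theorem substN_instS (σ : ℕ → Term) (j : ℕ) (φ : Form) :
    (φ.instS j).substN σ = (φ.substN σ).instS j := substN_renS _ _ _

/-- A strict upper bound for the free number variables of a formula. -/
def boundN : Form → ℕ
  | eq s t => max s.bound t.bound
  | lt s t => max s.bound t.bound
  | mem t _ => t.bound
  | falsum => 0
  | imp φ ψ => max φ.boundN ψ.boundN
  | allN φ => φ.boundN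
  | allS φ => φ.boundN

/-- A strict upper bound for the free set variables of a formula. -/
def boundS : Form → ℕ
  | eq _ _ => 0
  | lt _ _ => 0
  | mem _ X => X + 1
  | falsum => 0
  | imp φ ψ => max φ.boundS ψ.boundS
  | allN φ => φ.boundS
  | allS φ => φ.boundS

theorem substN_congr {σ τ : ℕ → Term} (φ : Form) (h : ∀ i < φ.boundN, σ i = τ i) :
    φ.substN σ = φ.substN τ := by
  induction φ generalizing σ τ with
  | eq s t | lt s t =>
    simp only [boundN, lt_max_iff] at h
    simp only [substN]
    rw [subst_congr s fun i hi => h i (.inl hi), subst_congr t fun i hi => h i (.inr hi)]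
  | mem t X => simp only [substN]; rw [subst_congr t h]
  | falsum => rfl
  | imp φ ψ hφ hψ =>
    simp only [boundN, lt_max_iff] at h
    simp only [substN]
    rw [hφ fun i hi => h i (.inl hi), hψ fun i hi => h i (.inr hi)]
  | allN φ ih =>
    simp only [substN]
    rw [ih]
    intro i hi
    cases i with
    | zero => rfl
    | succ i => simp only [liftSubst]; rw [h i (Nat.lt_of_succ_lt hi)]
  | allS φ ih => simp only [substN]; rw [ih h]

theorem renS_congr {ρ π : ℕ → ℕ} (φ : Form) (h : ∀ i < φ.boundS, ρ i = π i) :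
    φ.renS ρ = φ.renS π := by
  induction φ generalizing ρ π with
  | eq s t | lt s t | falsum => rfl
  | mem t X => simp only [renS]; rw [h X (by simp [boundS])]
  | imp φ ψ hφ hψ =>
    simp only [boundS, lt_max_iff] at h
    simp only [renS]
    rw [hφ fun i hi => h i (.inl hi), hψ fun i hi => h i (.inr hi)]
  | allN φ ih => simp only [renS]; rw [ih h]
  | allS φ ih =>
    simp only [renS]
    rw [ih]
    intro i hi
    cases i with
    | zero => rfl
    | succ i => simp only [liftRen]; rw [h i (Nat.lt_of_succ_lt hi)]

/-- An injective coding of formulas by natural numbers. -/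
def encode : Form → ℕ
  | eq s t => Nat.pair 0 (Nat.pair s.encode t.encode)
  | lt s t => Nat.pair 1 (Nat.pair s.encode t.encode)
  | mem t X => Nat.pair 2 (Nat.pair t.encode X)
  | falsum => Nat.pair 3 0
  | imp φ ψ => Nat.pair 4 (Nat.pair φ.encode ψ.encode)
  | allN φ => Nat.pair 5 φ.encode
  | allS φ => Nat.pair 6 φ.encode

theorem encode_injective : Function.Injective encode := by
  intro φ
  induction φ <;> intro ψ h <;> cases ψ <;>
    simp [encode, Nat.pair_eq_pair, Term.encode_injective.eq_iff] at h ⊢ <;> grind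

instance : Countable Form := encode_injective.countable

end Form

/-! ### Structural rules -/

namespace Derivable

variable {T : Set Form} {Γ Δ : List Form} {φ ψ : Form}

theorem weaken (h : Derivable T Γ φ) (hs : Γ ⊆ Δ) : Derivable T Δ φ := by
  induction h generalizing Δ with
  | ax h => exact .ax h
  | hyp h => exact .hyp (hs h)
  | impI _ ih => exact .impI (ih (List.cons_subset_cons _ hs))
  | impE _ _ ih₁ ih₂ => exact .impE (ih₁ hs) (ih₂ hs)
  | raa _ ih => exact .raa (ih (List.cons_subset_cons _ hs))
  | allNI _ ih => exact .allNI (ih (List.map_subset _ hs))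
  | allNE t _ ih => exact .allNE t (ih hs)
  | allSI _ ih => exact .allSI (ih (List.map_subset _ hs))
  | allSE j _ ih => exact .allSE j (ih hs)
  | eqRefl t => exact .eqRefl t
  | eqSubst φ _ _ ih₁ ih₂ => exact .eqSubst φ (ih₁ hs) (ih₂ hs)

theorem mono {T' : Set Form} (hT : ∀ φ ∈ T, Proves T' φ) (h : Derivable T Γ φ) :
    Derivable T' Γ φ := by
  induction h with
  | ax h => exact (hT _ h).weaken (List.nil_subset _)
  | hyp h => exact .hyp h
  | impI _ ih => exact .impI ih
  | impE _ _ ih₁ ih₂ => exact .impE ih₁ ih₂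
  | raa _ ih => exact .raa ih
  | allNI _ ih => exact .allNI ih
  | allNE t _ ih => exact .allNE t ih
  | allSI _ ih => exact .allSI ih
  | allSE j _ ih => exact .allSE j ih
  | eqRefl t => exact .eqRefl t
  | eqSubst φ _ _ ih₁ ih₂ => exact .eqSubst φ ih₁ ih₂

/-- Induction on the derivation. Axioms may contain free variables, so the axiom case needs `T` to
be closed under substitution. -/
theorem substN (hT : ∀ φ ∈ T, ∀ σ, φ.substN σ ∈ T) (h : Derivable T Γ φ) (σ : ℕ → Term) :
    Derivable T (Γ.map (Form.substN σ)) (φ.substN σ) := by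
  induction h generalizing σ with
  | ax h => exact .ax (hT _ h σ)
  | hyp h => exact .hyp (List.mem_map_of_mem h)
  | impI _ ih => exact .impI (ih σ)
  | impE _ _ ih₁ ih₂ => exact .impE (ih₁ σ) (ih₂ σ)
  | raa _ ih => exact .raa (ih σ)
  | allNI _ ih =>
    refine .allNI ?_
    have := ih (liftSubst σ)
    simpa [Function.comp_def, substN_shiftN] using this
  | allNE t _ ih =>
    rw [substN_instN]
    exact .allNE _ (ih σ)
  | allSI _ ih =>
    refine .allSI ?_
    have := ih σ
    simpa [Function.comp_def, shiftS, substN_renS] using this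
  | allSE j _ ih =>
    rw [substN_instS]
    exact .allSE j (ih σ)
  | eqRefl t => exact .eqRefl _
  | eqSubst φ _ _ ih₁ ih₂ =>
    simp only [substN_instN] at ih₂ ⊢
    exact .eqSubst _ (ih₁ σ) (ih₂ σ)

theorem renS (hT : ∀ φ ∈ T, ∀ ρ, φ.renS ρ ∈ T) (h : Derivable T Γ φ) (ρ : ℕ → ℕ) :
    Derivable T (Γ.map (Form.renS ρ)) (φ.renS ρ) := by
  induction h generalizing ρ with
  | ax h => exact .ax (hT _ h ρ)
  | hyp h => exact .hyp (List.mem_map_of_mem h)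
  | impI _ ih => exact .impI (ih ρ)
  | impE _ _ ih₁ ih₂ => exact .impE (ih₁ ρ) (ih₂ ρ)
  | raa _ ih => exact .raa (ih ρ)
  | allNI _ ih =>
    refine .allNI ?_
    have := ih ρ
    simpa [Function.comp_def, shiftN, substN_renS] using this
  | allNE t _ ih =>
    rw [renS_instN]
    exact .allNE _ (ih ρ)
  | allSI _ ih =>
    refine .allSI ?_
    have := ih (liftRen ρ)
    simpa [Function.comp_def, renS_shiftS] using this
  | allSE j _ ih =>
    rw [renS_instS]
    exact .allSE _ (ih ρ)
  | eqRefl t => exact .eqRefl _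
  | eqSubst φ _ _ ih₁ ih₂ =>
    simp only [renS_instN] at ih₂ ⊢
    exact .eqSubst _ (ih₁ ρ) (ih₂ ρ)

theorem absurd (h₁ : Derivable T Γ (neg φ)) (h₂ : Derivable T Γ φ) : Derivable T Γ ψ :=
  .raa ((impE h₁ h₂).weaken (List.subset_cons_self _ _))

end Derivable

/-! ### Substitution into theorems. -/

/-- In the empty context variable `0` may be generalized and then instantiated. Each such step
lowers the remaining variables by one, so `m` steps perform exactly the substitutions that lower the
variables from `m` on by `m`. -/
theorem Proves.substN_of_lower {T : Set Form} (m : ℕ) :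
    ∀ (σ : ℕ → Term) (φ : Form), (∀ i, σ (i + m) = var i) → Proves T φ →
      Proves T (φ.substN σ) := by
  induction m with
  | zero =>
    intro σ φ hσ h
    rwa [show σ = var from funext hσ, substN_var]
  | succ m ih =>
    intro σ φ hσ h
    -- The term for variable `0` is raised by `m`, since the remaining steps lower its variables
    -- again.
    have key := ih (fun i => σ (i + 1)) (φ.instN ((σ 0).subst fun i => var (i + m)))
      (fun i => by rw [← hσ i]; congr 1) (.allNE _ (.allNI h))
    rw [instN, substN_substN] at key
    convert key using 2
    funext i
    cases i with
    | zero =>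
      simp only [instTerm, subst_subst, subst]
      conv_lhs => rw [← subst_var (σ 0)]
      congr 1
      funext i
      rw [← hσ i]
      congr 1
    | succ i => rfl

/-- Above the free variables of `φ` the substitution is immaterial, so it can be changed there to a
lowering by `φ.boundN`. -/
theorem Proves.substN {T : Set Form} {φ : Form} (h : Proves T φ) (σ : ℕ → Term) :
    Proves T (φ.substN σ) := by
  have := Proves.substN_of_lower φ.boundN
    (fun i => if i < φ.boundN then σ i else var (i - φ.boundN)) φ (by simp) h
  rwa [substN_congr (τ := σ) φ (fun i hi => by simp [hi])] at this

theorem Proves.renS_of_lower {T : Set Form} (m : ℕ) :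
    ∀ (ρ : ℕ → ℕ) (φ : Form), (∀ i, ρ (i + m) = i) → Proves T φ → Proves T (φ.renS ρ) := by
  induction m with
  | zero =>
    intro ρ φ hρ h
    rwa [show ρ = id from funext hρ, renS_id]
  | succ m ih =>
    intro ρ φ hρ h
    have key := ih (fun i => ρ (i + 1)) (φ.instS (ρ 0 + m))
      (fun i => hρ i) (.allSE _ (.allSI h))
    rw [instS, renS_renS] at key
    convert key using 2
    funext i
    cases i with
    | zero => exact (hρ (ρ 0)).symm
    | succ i => rfl

theorem Proves.renS {T : Set Form} {φ : Form} (h : Proves T φ) (ρ : ℕ → ℕ) :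
    Proves T (φ.renS ρ) := by
  have := Proves.renS_of_lower φ.boundS
    (fun i => if i < φ.boundS then ρ i else i - φ.boundS) φ (by simp) h
  rwa [renS_congr (π := ρ) φ (fun i hi => by simp [hi])] at this

/-! ### Semantics -/

/-- Structures for the language `L₂`, with a general domain of sets. -/
structure Struct where
  Num : Type
  Sets : Type
  zero : Num
  one : Num
  add : Num → Num → Num
  mul : Num → Num → Num
  lt : Num → Num → Prop
  mem : Num → Sets → Prop

/-- Prepend a value to an assignment. -/
def cons {α : Type} (a : α) (v : ℕ → α) : ℕ → α
  | 0 => a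
  | i + 1 => v i

@[simp] theorem cons_zero {α : Type} (a : α) (v : ℕ → α) : cons a v 0 = a := rfl
@[simp] theorem cons_succ {α : Type} (a : α) (v : ℕ → α) (i : ℕ) : cons a v (i + 1) = v i := rfl
@[simp] theorem cons_one {α : Type} (a : α) (v : ℕ → α) : cons a v 1 = v 0 := rfl

/-- The value of a term under an assignment. -/
def Term.eval (𝓢 : Struct) (v : ℕ → 𝓢.Num) : Term → 𝓢.Num
  | var i => v i
  | zero => 𝓢.zero
  | one => 𝓢.one
  | add s t => 𝓢.add (s.eval 𝓢 v) (t.eval 𝓢 v)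
  | mul s t => 𝓢.mul (s.eval 𝓢 v) (t.eval 𝓢 v)

/-- Satisfaction of a formula under assignments for the number and the set variables. -/
def Form.Sat (𝓢 : Struct) : (ℕ → 𝓢.Num) → (ℕ → 𝓢.Sets) → Form → Prop
  | v, _, eq s t => s.eval 𝓢 v = t.eval 𝓢 v
  | v, _, lt s t => 𝓢.lt (s.eval 𝓢 v) (t.eval 𝓢 v)
  | v, e, mem t X => 𝓢.mem (t.eval 𝓢 v) (e X)
  | _, _, falsum => False
  | v, e, imp φ ψ => φ.Sat 𝓢 v e → ψ.Sat 𝓢 v e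
  | v, e, allN φ => ∀ a, φ.Sat 𝓢 (cons a v) e
  | v, e, allS φ => ∀ X, φ.Sat 𝓢 v (cons X e)

theorem Term.eval_subst {𝓢 : Struct} (v : ℕ → 𝓢.Num) (σ : ℕ → Term) (t : Term) :
    (t.subst σ).eval 𝓢 v = t.eval 𝓢 fun i => (σ i).eval 𝓢 v := by
  induction t <;> simp_all [subst, eval]

theorem Term.eval_shift {𝓢 : Struct} (v : ℕ → 𝓢.Num) (a : 𝓢.Num) (t : Term) :
    t.shift.eval 𝓢 (cons a v) = t.eval 𝓢 v := by
  rw [shift, eval_subst]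
  rfl

theorem Form.sat_substN {𝓢 : Struct} (v : ℕ → 𝓢.Num) (e : ℕ → 𝓢.Sets) (σ : ℕ → Term)
    (φ : Form) : (φ.substN σ).Sat 𝓢 v e ↔ φ.Sat 𝓢 (fun i => (σ i).eval 𝓢 v) e := by
  induction φ generalizing v e σ with
  | eq s t | lt s t | mem t X => simp [substN, Sat, eval_subst]
  | falsum => rfl
  | imp φ ψ hφ hψ => simp [substN, Sat, hφ, hψ]
  | allN φ ih =>
    simp only [substN, Sat, ih]
    refine forall_congr' fun a => ?_
    congr! 1
    funext i
    cases i with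
    | zero => rfl
    | succ i => exact eval_shift v a (σ i)
  | allS φ ih => simp only [substN, Sat, ih]

theorem Form.sat_renS {𝓢 : Struct} (v : ℕ → 𝓢.Num) (e : ℕ → 𝓢.Sets) (ρ : ℕ → ℕ)
    (φ : Form) : (φ.renS ρ).Sat 𝓢 v e ↔ φ.Sat 𝓢 v (fun i => e (ρ i)) := by
  induction φ generalizing v e ρ with
  | eq s t | lt s t | mem t X | falsum => rfl
  | imp φ ψ hφ hψ => simp [renS, Sat, hφ, hψ]
  | allN φ ih => simp only [renS, Sat, ih]
  | allS φ ih =>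
    simp only [renS, Sat, ih]
    refine forall_congr' fun a => ?_
    congr! 1
    funext i
    cases i <;> rfl

/-! ### The completeness theorem -/

/-- A finite list of assumptions that is consistent with `T`. -/
def Consistent (T : Set Form) (Γ : List Form) : Prop := ¬ Derivable T Γ falsum

section Henkin

variable {T : Set Form}

theorem Consistent.cons_neg {Γ : List Form} {φ : Form} (h : Consistent T Γ)
    (hφ : Derivable T (φ :: Γ) falsum) : Consistent T (neg φ :: Γ) :=
  fun h' => h (.impE (.impI hφ) (.raa h'))

theorem exists_bound {α : Type} (f : α → ℕ) (Γ : List α) : ∃ m, ∀ φ ∈ Γ, f φ ≤ m :=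
  ⟨(Γ.map f).sum, fun φ h => List.single_le_sum (by simp) _ (List.mem_map_of_mem h)⟩

/-- A variable `m` that is fresh for `ψ` and the context serves as the counterexample: moving it to
index `0` and raising all others turns a derivation of `ψ(m)` into the premise of `allNI`. -/
theorem Consistent.witnessN (hT : ∀ φ ∈ T, ∀ σ, φ.substN σ ∈ T) {Γ : List Form} {ψ : Form}
    (h : Consistent T (neg (allN ψ) :: Γ)) :
    ∃ t, Consistent T (neg (instN t ψ) :: neg (allN ψ) :: Γ) := by
  obtain ⟨m, hm⟩ := exists_bound boundN (ψ :: neg (allN ψ) :: Γ)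
  refine ⟨var m, fun h' => h ?_⟩
  refine .impE (.hyp List.mem_cons_self) (.allNI ?_)
  have key := (Derivable.raa h').substN hT fun i => if i = m then var 0 else var (i + 1)
  convert key using 1
  · refine List.map_congr_left fun φ hφ => substN_congr _ fun i hi => ?_
    have := hm φ (List.mem_cons_of_mem _ hφ)
    rw [if_neg (by omega)]
  · rw [instN, substN_substN]
    conv_lhs => rw [← substN_var ψ]
    refine substN_congr _ fun i hi => ?_
    have := hm ψ List.mem_cons_self
    cases i with
    | zero => simp [instTerm, subst]
    | succ i => simp only [instTerm, subst]; rw [if_neg (by omega)]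

theorem Consistent.witnessS (hT : ∀ φ ∈ T, ∀ ρ, φ.renS ρ ∈ T) {Γ : List Form} {ψ : Form}
    (h : Consistent T (neg (allS ψ) :: Γ)) :
    ∃ j, Consistent T (neg (instS j ψ) :: neg (allS ψ) :: Γ) := by
  obtain ⟨m, hm⟩ := exists_bound boundS (ψ :: neg (allS ψ) :: Γ)
  refine ⟨m, fun h' => h ?_⟩
  refine .impE (.hyp List.mem_cons_self) (.allSI ?_)
  have key := (Derivable.raa h').renS hT fun i => if i = m then 0 else i + 1
  convert key using 1
  · refine List.map_congr_left fun φ hφ => renS_congr _ fun i hi => ?_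
    have := hm φ (List.mem_cons_of_mem _ hφ)
    rw [if_neg (by omega)]
  · rw [instS, renS_renS]
    conv_lhs => rw [← renS_id ψ]
    refine renS_congr _ fun i hi => ?_
    have := hm ψ List.mem_cons_self
    cases i with
    | zero => simp [instSet]
    | succ i =>
      have hne : i ≠ m := by omega
      simp [instSet, hne]

/-- `Γ` decides `φ`, with a counterexample if `φ` is a refuted universal formula. -/
def Decides (Γ : List Form) (φ : Form) : Prop :=
  φ ∈ Γ ∨ neg φ ∈ Γ ∧ (∀ ψ, φ = allN ψ → ∃ t, neg (instN t ψ) ∈ Γ) ∧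
    ∀ ψ, φ = allS ψ → ∃ j, neg (instS j ψ) ∈ Γ

theorem Consistent.exists_decides (hN : ∀ φ ∈ T, ∀ σ, φ.substN σ ∈ T)
    (hS : ∀ φ ∈ T, ∀ ρ, φ.renS ρ ∈ T) {Γ : List Form} (h : Consistent T Γ) (φ : Form) :
    ∃ Δ, Γ ⊆ Δ ∧ Consistent T Δ ∧ Decides Δ φ := by
  by_cases hφ : Consistent T (φ :: Γ)
  · exact ⟨_, List.subset_cons_self _ _, hφ, .inl List.mem_cons_self⟩
  have h' := h.cons_neg (not_not.1 hφ)
  have hsub := List.subset_cons_self (neg φ) Γ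
  by_cases h₁ : ∃ ψ, φ = allN ψ
  · obtain ⟨ψ, rfl⟩ := h₁
    obtain ⟨t, ht⟩ := h'.witnessN hN
    exact ⟨_, List.Subset.trans hsub (List.subset_cons_self _ _), ht, .inr
      ⟨by simp, fun _ e => ⟨t, by cases e; simp⟩, fun _ e => by cases e⟩⟩
  by_cases h₂ : ∃ ψ, φ = allS ψ
  · obtain ⟨ψ, rfl⟩ := h₂
    obtain ⟨t, ht⟩ := h'.witnessS hS
    exact ⟨_, List.Subset.trans hsub (List.subset_cons_self _ _), ht, .inr
      ⟨by simp, (fun _ e => by cases e), fun _ e => ⟨t, by cases e; simp⟩⟩⟩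
  exact ⟨_, hsub, h', .inr
    ⟨by simp, fun ψ e => (h₁ ⟨ψ, e⟩).elim, fun ψ e => (h₂ ⟨ψ, e⟩).elim⟩⟩

/-- Complete theories that contain counterexamples to all refuted universal formulas. -/
structure IsHenkin (T : Set Form) (Δ : Set Form) : Prop where
  closed : ∀ Γ : List Form, (∀ φ ∈ Γ, φ ∈ Δ) → ∀ φ, Derivable T Γ φ → φ ∈ Δ
  falsum_notMem : falsum ∉ Δ
  em : ∀ φ, φ ∈ Δ ∨ neg φ ∈ Δ
  allN_mem : ∀ ψ, (∀ t, instN t ψ ∈ Δ) → allN ψ ∈ Δ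
  allS_mem : ∀ ψ, (∀ j, instS j ψ ∈ Δ) → allS ψ ∈ Δ

/-- There are countably many formulas, so they can be decided one at a time. Every stage is a finite
list, which leaves fresh variables for counterexamples, and a derivation from the union already uses
only one stage. -/
theorem Consistent.exists_isHenkin (hN : ∀ φ ∈ T, ∀ σ, φ.substN σ ∈ T)
    (hS : ∀ φ ∈ T, ∀ ρ, φ.renS ρ ∈ T) {Γ : List Form} (h : Consistent T Γ) :
    ∃ Δ, IsHenkin T Δ ∧ ∀ φ ∈ Γ, φ ∈ Δ := by
  have : Nonempty Form := ⟨falsum⟩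
  obtain ⟨f, hf⟩ := exists_surjective_nat Form
  choose! next hsub hcon hdec using
    fun (Γ : List Form) (h : Consistent T Γ) (φ : Form) => h.exists_decides hN hS φ
  let G : ℕ → List Form := fun k => Nat.rec Γ (fun k Γ => next Γ (f k)) k
  have hG : ∀ k, Consistent T (G k) := fun k => by
    induction k with
    | zero => exact h
    | succ k ih => exact hcon _ ih _
  have hmono : Monotone fun k => {φ | φ ∈ G k} :=
    monotone_nat_of_le_succ fun k => hsub _ (hG k) (f k)
  have hD : ∀ k, Decides (G (k + 1)) (f k) := fun k => hdec _ (hG k) (f k)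
  have hfin : ∀ Λ : List Form, (∀ φ ∈ Λ, ∃ k, φ ∈ G k) → ∃ k, Λ ⊆ G k := by
    intro Λ
    induction Λ with
    | nil => exact fun _ => ⟨0, List.nil_subset _⟩
    | cons φ Λ ih =>
      intro hΛ
      obtain ⟨k, hk⟩ := hΛ φ List.mem_cons_self
      obtain ⟨l, hl⟩ := ih fun ψ hψ => hΛ ψ (List.mem_cons_of_mem _ hψ)
      refine ⟨max k l, List.cons_subset.2 ⟨hmono (le_max_left k l) hk, fun ψ hψ => ?_⟩⟩
      exact hmono (le_max_right k l) (hl hψ)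
  have hcons : ∀ Λ : List Form, (∀ φ ∈ Λ, ∃ k, φ ∈ G k) → Consistent T Λ := fun Λ hΛ h => by
    obtain ⟨k, hk⟩ := hfin Λ hΛ
    exact hG k (h.weaken hk)
  have hem : ∀ φ, (∃ k, φ ∈ G k) ∨ ∃ k, neg φ ∈ G k := fun φ => by
    obtain ⟨k, rfl⟩ := hf φ
    rcases hD k with h | h
    exacts [.inl ⟨k + 1, h⟩, .inr ⟨k + 1, h.1⟩]
  refine ⟨{φ | ∃ k, φ ∈ G k}, ⟨fun Λ hΛ φ hφ => ?_, ?_, hem, fun ψ hψ => ?_, fun ψ hψ => ?_⟩,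
    fun φ hφ => ⟨0, hφ⟩⟩
  · refine (hem φ).resolve_right fun hn => hcons (neg φ :: Λ) ?_ ?_
    · intro ψ hψ
      rcases List.mem_cons.1 hψ with rfl | hψ
      exacts [hn, hΛ _ hψ]
    · exact .impE (.hyp List.mem_cons_self) (hφ.weaken (List.subset_cons_self _ _))
  · rintro ⟨k, hk⟩
    exact hG k (.hyp hk)
  · obtain ⟨k, hk⟩ := hf (allN ψ)
    rcases hk ▸ hD k with h | ⟨-, h, -⟩
    · exact ⟨k + 1, h⟩
    obtain ⟨t, ht⟩ := h ψ rfl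
    refine (hcons [neg (instN t ψ), instN t ψ] ?_ ?_).elim
    · simpa using ⟨⟨k + 1, ht⟩, hψ t⟩
    · exact .impE (φ := instN t ψ) (.hyp List.mem_cons_self) (.hyp (by simp))
  · obtain ⟨k, hk⟩ := hf (allS ψ)
    rcases hk ▸ hD k with h | ⟨-, -, h⟩
    · exact ⟨k + 1, h⟩
    obtain ⟨t, ht⟩ := h ψ rfl
    refine (hcons [neg (instS t ψ), instS t ψ] ?_ ?_).elim
    · simpa using ⟨⟨k + 1, ht⟩, hψ t⟩
    · exact .impE (φ := instS t ψ) (.hyp List.mem_cons_self) (.hyp (by simp))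

namespace IsHenkin

variable {Δ : Set Form}

theorem mp (H : IsHenkin T Δ) {φ ψ : Form} (h : imp φ ψ ∈ Δ) (hφ : φ ∈ Δ) : ψ ∈ Δ :=
  H.closed [imp φ ψ, φ] (by simp [h, hφ]) _
    (.impE (φ := φ) (.hyp (by simp)) (.hyp (by simp)))

theorem neg_mem (H : IsHenkin T Δ) {φ : Form} : neg φ ∈ Δ ↔ φ ∉ Δ :=
  ⟨fun h h' => H.falsum_notMem (H.mp h h'), (H.em φ).resolve_left⟩

theorem imp_mem (H : IsHenkin T Δ) {φ ψ : Form} : imp φ ψ ∈ Δ ↔ (φ ∈ Δ → ψ ∈ Δ) := by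
  refine ⟨H.mp, fun h => ?_⟩
  rcases H.em φ with hφ | hφ
  · exact H.closed [ψ] (by simp [h hφ]) _ (.impI (.hyp (by simp)))
  · exact H.closed [neg φ] (by simp [hφ]) _
      (.impI (Derivable.absurd (φ := φ) (.hyp (by simp)) (.hyp (by simp))))

theorem allN_mem_iff (H : IsHenkin T Δ) {φ : Form} : allN φ ∈ Δ ↔ ∀ t, instN t φ ∈ Δ :=
  ⟨fun h t => H.closed [allN φ] (by simp [h]) _ (.allNE t (.hyp (by simp))), H.allN_mem φ⟩

theorem allS_mem_iff (H : IsHenkin T Δ) {φ : Form} : allS φ ∈ Δ ↔ ∀ j, instS j φ ∈ Δ :=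
  ⟨fun h t => H.closed [allS φ] (by simp [h]) _ (.allSE t (.hyp (by simp))), H.allS_mem φ⟩

theorem eq_refl (H : IsHenkin T Δ) (t : Term) : eq t t ∈ Δ :=
  H.closed [] (by simp) _ (.eqRefl t)

theorem eq_subst (H : IsHenkin T Δ) {s t : Term} (φ : Form) (h : eq s t ∈ Δ)
    (hs : instN s φ ∈ Δ) : instN t φ ∈ Δ :=
  H.closed [eq s t, instN s φ] (by simp [h, hs]) _
    (.eqSubst (s := s) φ (.hyp (by simp)) (.hyp (by simp)))

theorem eq_symm (H : IsHenkin T Δ) {s t : Term} (h : eq s t ∈ Δ) : eq t s ∈ Δ := by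
  have := H.eq_subst (eq (var 0) s.shift) h
  simp only [instN, substN, shift_subst_instTerm] at this
  exact this (H.eq_refl s)

theorem eq_trans (H : IsHenkin T Δ) {s t u : Term} (h : eq s t ∈ Δ) (h' : eq t u ∈ Δ) :
    eq s u ∈ Δ := by
  have := H.eq_subst (eq s.shift (var 0)) h'
  simp only [instN, substN, shift_subst_instTerm] at this
  exact this h

theorem eq_congr (H : IsHenkin T Δ) {s t : Term} (u : Term) (h : eq s t ∈ Δ) :
    eq (u.subst (instTerm s)) (u.subst (instTerm t)) ∈ Δ := by
  have := H.eq_subst (eq (u.subst (instTerm s)).shift u) h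
  simp only [instN, substN, shift_subst_instTerm] at this
  exact this (H.eq_refl _)

theorem mem_iff_of_eq (H : IsHenkin T Δ) {s t : Term} (φ : Form) (h : eq s t ∈ Δ) :
    instN s φ ∈ Δ ↔ instN t φ ∈ Δ :=
  ⟨H.eq_subst φ h, H.eq_subst φ (H.eq_symm h)⟩

theorem eq_add (H : IsHenkin T Δ) {s t s' t' : Term} (h : eq s s' ∈ Δ) (h' : eq t t' ∈ Δ) :
    eq (add s t) (add s' t') ∈ Δ := by
  have h₁ := H.eq_congr (add (var 0) t.shift) h
  have h₂ := H.eq_congr (add s'.shift (var 0)) h'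
  simp only [subst, shift_subst_instTerm] at h₁ h₂
  exact H.eq_trans h₁ h₂

theorem eq_mul (H : IsHenkin T Δ) {s t s' t' : Term} (h : eq s s' ∈ Δ) (h' : eq t t' ∈ Δ) :
    eq (mul s t) (mul s' t') ∈ Δ := by
  have h₁ := H.eq_congr (mul (var 0) t.shift) h
  have h₂ := H.eq_congr (mul s'.shift (var 0)) h'
  simp only [subst, shift_subst_instTerm] at h₁ h₂
  exact H.eq_trans h₁ h₂

theorem lt_iff_of_eq (H : IsHenkin T Δ) {s t s' t' : Term} (h : eq s s' ∈ Δ)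
    (h' : eq t t' ∈ Δ) : lt s t ∈ Δ ↔ lt s' t' ∈ Δ := by
  have h₁ := H.mem_iff_of_eq (lt (var 0) t.shift) h
  have h₂ := H.mem_iff_of_eq (lt s'.shift (var 0)) h'
  simp only [instN, substN, shift_subst_instTerm] at h₁ h₂
  exact h₁.trans h₂

/-- Provable equality of terms. -/
def setoid (H : IsHenkin T Δ) : Setoid Term where
  r s t := eq s t ∈ Δ
  iseqv := ⟨H.eq_refl, H.eq_symm, H.eq_trans⟩

/-- The term model: terms up to provable equality, and the set variables as sets. -/
def termModel (H : IsHenkin T Δ) : Struct where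
  Num := Quotient H.setoid
  Sets := ℕ
  zero := Quotient.mk _ zero
  one := Quotient.mk _ one
  add := Quotient.map₂ add fun _ _ h _ _ h' => H.eq_add h h'
  mul := Quotient.map₂ mul fun _ _ h _ _ h' => H.eq_mul h h'
  lt := Quotient.lift₂ (fun s t => lt s t ∈ Δ) fun _ _ _ _ h h' =>
    propext (H.lt_iff_of_eq h h')
  mem := Quotient.lift (fun t X => mem t X ∈ Δ) fun _ _ h =>
    funext fun X => propext (H.mem_iff_of_eq (mem (var 0) X) h)

/-- The element of the term model named by a term. -/
def cls (H : IsHenkin T Δ) (t : Term) : H.termModel.Num := Quotient.mk H.setoid t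

theorem cls_surjective (H : IsHenkin T Δ) : Function.Surjective H.cls := Quotient.mk_surjective

theorem cls_eq_cls (H : IsHenkin T Δ) {s t : Term} : H.cls s = H.cls t ↔ eq s t ∈ Δ := Quotient.eq

theorem eval_termModel (H : IsHenkin T Δ) (σ : ℕ → Term) (t : Term) :
    t.eval H.termModel (fun i => H.cls (σ i)) = H.cls (t.subst σ) := by
  induction t with
  | var i | zero | one => rfl
  | add s t hs ht | mul s t hs ht => simp only [eval, hs, ht]; rfl

/-- The truth lemma. The quantifier cases hold because every number of the model is named by a term,
every set is a set variable, and `Δ` contains a universal formula as soon as it contains all its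
instances. -/
theorem sat_termModel (H : IsHenkin T Δ) (σ : ℕ → Term) (ρ : ℕ → ℕ) (φ : Form) :
    φ.Sat H.termModel (fun i => H.cls (σ i)) ρ ↔ (φ.substN σ).renS ρ ∈ Δ := by
  induction φ generalizing σ ρ with
  | eq s t => simp only [Sat, eval_termModel, substN, renS, cls_eq_cls]
  | lt s t | mem t X =>
    simp only [Sat, eval_termModel, substN, renS]
    rfl
  | falsum => exact (iff_false_intro H.falsum_notMem).symm
  | imp φ ψ hφ hψ => simp only [Sat, hφ, hψ, substN, renS, H.imp_mem]
  | allN φ ih =>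
    simp only [Sat, substN, renS, H.allN_mem_iff, H.cls_surjective.forall]
    refine forall_congr' fun t => ?_
    have hc : (cons (H.cls t) fun i => H.cls (σ i)) =
        fun i => H.cls ((liftSubst σ i).subst (instTerm t)) := by
      funext i
      cases i with
      | zero => rfl
      | succ i => simp only [liftSubst, shift_subst_instTerm, cons_succ]
    rw [← renS_instN, instN, substN_substN, hc, ih]
  | allS φ ih =>
    simp only [Sat, substN, renS, H.allS_mem_iff]
    refine forall_congr' fun (j : ℕ) => ?_
    have hc : cons j ρ = fun i => instSet j (liftRen ρ i) := by
      funext i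
      cases i <;> rfl
    rw [instS, renS_renS, ← hc]
    exact ih σ (cons j ρ)

end IsHenkin

end Henkin

/-- `𝓢` is a model of `T`; free variables are understood as universally quantified. -/
def Models (𝓢 : Struct) (T : Set Form) : Prop := ∀ φ ∈ T, ∀ v e, φ.Sat 𝓢 v e

/-- The completeness theorem. -/
theorem proves_of_countable_models {T : Set Form} {χ : Form}
    (h : ∀ 𝓢 : Struct, Countable 𝓢.Num → Countable 𝓢.Sets → Nonempty 𝓢.Sets → Models 𝓢 T →
      ∀ v e, χ.Sat 𝓢 v e) : Proves T χ := by
  -- Axioms are read universally, so closing `T` under substitution and renaming adds only theorems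
  -- of `T`.
  let T' : Set Form := {ψ | ∃ φ ∈ T, ∃ σ ρ, ψ = (φ.substN σ).renS ρ}
  have hN : ∀ φ ∈ T', ∀ σ, φ.substN σ ∈ T' := by
    rintro _ ⟨φ, hφ, τ, ρ, rfl⟩ σ
    exact ⟨φ, hφ, _, ρ, by rw [substN_renS, substN_substN]⟩
  have hS : ∀ φ ∈ T', ∀ ρ, φ.renS ρ ∈ T' := by
    rintro _ ⟨φ, hφ, σ, π, rfl⟩ ρ
    exact ⟨φ, hφ, σ, _, by rw [renS_renS]⟩
  refine Derivable.mono (T := T') ?_ ?_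
  · rintro _ ⟨φ, hφ, σ, ρ, rfl⟩
    exact Proves.renS (Proves.substN (.ax hφ) σ) ρ
  by_contra hχ
  have hcon : Consistent T' [neg χ] := fun h => hχ (.raa h)
  obtain ⟨Δ, H, hΔ⟩ := hcon.exists_isHenkin hN hS
  have hc : Countable H.termModel.Num := H.cls_surjective.countable
  have := h H.termModel hc (inferInstanceAs (Countable ℕ)) ⟨(0 : ℕ)⟩ ?_
    (fun i => H.cls (var i)) id
  · rw [H.sat_termModel, substN_var, renS_id] at this
    exact H.neg_mem.1 (hΔ _ (by simp)) this
  · intro φ hφ v e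
    choose σ hσ using fun i => H.cls_surjective (v i)
    rw [← funext hσ]
    exact (H.sat_termModel σ e φ).2 (H.closed [] (by simp) _ (.ax ⟨φ, hφ, _, _, rfl⟩))

/-! ### Satisfaction of the derived connectives and quantifiers. -/

namespace Form

variable {𝓢 : Struct} {v : ℕ → 𝓢.Num} {e : ℕ → 𝓢.Sets}

@[simp] theorem sat_eq {s t : Term} : (eq s t).Sat 𝓢 v e ↔ s.eval 𝓢 v = t.eval 𝓢 v := Iff.rfl

@[simp] theorem sat_lt {s t : Term} : (lt s t).Sat 𝓢 v e ↔ 𝓢.lt (s.eval 𝓢 v) (t.eval 𝓢 v) :=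
  Iff.rfl

@[simp] theorem sat_mem {t : Term} {X : ℕ} : (mem t X).Sat 𝓢 v e ↔ 𝓢.mem (t.eval 𝓢 v) (e X) :=
  Iff.rfl

@[simp] theorem sat_falsum : falsum.Sat 𝓢 v e ↔ False := Iff.rfl

@[simp] theorem sat_imp {φ ψ : Form} : (imp φ ψ).Sat 𝓢 v e ↔ (φ.Sat 𝓢 v e → ψ.Sat 𝓢 v e) :=
  Iff.rfl

@[simp] theorem sat_allN {φ : Form} : (allN φ).Sat 𝓢 v e ↔ ∀ a, φ.Sat 𝓢 (cons a v) e := Iff.rfl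

@[simp] theorem sat_allS {φ : Form} : (allS φ).Sat 𝓢 v e ↔ ∀ X, φ.Sat 𝓢 v (cons X e) := Iff.rfl

@[simp] theorem sat_neg {φ : Form} : (neg φ).Sat 𝓢 v e ↔ ¬ φ.Sat 𝓢 v e := Iff.rfl

@[simp] theorem sat_and {φ ψ : Form} :
    (and φ ψ).Sat 𝓢 v e ↔ φ.Sat 𝓢 v e ∧ ψ.Sat 𝓢 v e := by
  simp [and]

@[simp] theorem sat_or {φ ψ : Form} :
    (or φ ψ).Sat 𝓢 v e ↔ φ.Sat 𝓢 v e ∨ ψ.Sat 𝓢 v e := by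
  simp [or, or_iff_not_imp_left]

@[simp] theorem sat_iff {φ ψ : Form} :
    (iff φ ψ).Sat 𝓢 v e ↔ (φ.Sat 𝓢 v e ↔ ψ.Sat 𝓢 v e) := by
  simp [iff, iff_iff_implies_and_implies]

@[simp] theorem sat_exN {φ : Form} : (exN φ).Sat 𝓢 v e ↔ ∃ a, φ.Sat 𝓢 (cons a v) e := by
  simp [exN]

@[simp] theorem sat_exS {φ : Form} : (exS φ).Sat 𝓢 v e ↔ ∃ X, φ.Sat 𝓢 v (cons X e) := by
  simp [exS]

@[simp] theorem sat_ballN {t : Term} {φ : Form} :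
    (ballN t φ).Sat 𝓢 v e ↔ ∀ a, 𝓢.lt a (t.eval 𝓢 v) → φ.Sat 𝓢 (cons a v) e := by
  simp [ballN, eval, eval_shift]

end Form

/-- Countable models of `RCA₀`, with enumerations of the two domains. -/
structure Model extends Struct where
  num : ℕ → Num
  num_surjective : Function.Surjective num
  set : ℕ → Sets
  set_surjective : Function.Surjective set
  models : Models toStruct RCA0

theorem proves_of_sat {χ : Form}
    (h : ∀ (𝓜 : Model) (v : ℕ → 𝓜.Num) (e : ℕ → 𝓜.Sets), χ.Sat 𝓜.toStruct v e) :
    Proves RCA0 χ := by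
  refine proves_of_countable_models fun 𝓢 h₁ h₂ h₃ hm v e => ?_
  have : Nonempty 𝓢.Num := ⟨𝓢.zero⟩
  obtain ⟨f, hf⟩ := exists_surjective_nat 𝓢.Num
  obtain ⟨g, hg⟩ := exists_surjective_nat 𝓢.Sets
  exact h ⟨𝓢, f, hf, g, hg, hm⟩ v e

variable {𝓜 : Model}

instance : Zero 𝓜.Num := ⟨𝓜.zero⟩
instance : One 𝓜.Num := ⟨𝓜.one⟩
instance : Add 𝓜.Num := ⟨𝓜.add⟩
instance : Mul 𝓜.Num := ⟨𝓜.mul⟩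
instance : LT 𝓜.Num := ⟨𝓜.lt⟩
instance : Membership 𝓜.Num 𝓜.Sets := ⟨fun X x => 𝓜.mem x X⟩

/-! ### Definability with parameters -/

/-- The assignment that extends a finite tuple by the enumeration of all numbers. -/
def extend {k : ℕ} (w : Fin k → 𝓜.Num) (i : ℕ) : 𝓜.Num :=
  if h : i < k then w ⟨i, h⟩ else 𝓜.num (i - k)

theorem extend_cons {k : ℕ} (a : 𝓜.Num) (w : Fin k → 𝓜.Num) :
    extend (Fin.cons a w : Fin (k + 1) → 𝓜.Num) = cons a (extend w) := by
  funext i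
  cases i with
  | zero => simp [extend]
  | succ i =>
    simp only [extend, cons_succ, Nat.add_lt_add_iff_right, Nat.add_sub_add_right]
    split_ifs with h
    · exact Fin.cons_succ (α := fun _ => 𝓜.Num) a w ⟨i, h⟩
    · rfl

/-- Functions given by terms with parameters. -/
class DefT {k : ℕ} (f : (Fin k → 𝓜.Num) → 𝓜.Num) : Prop where
  exists_term : ∃ t : Term, ∀ w, t.eval 𝓜.toStruct (extend w) = f w

/-- Relations given by bounded quantifier formulas with parameters. -/
class DefB {k : ℕ} (P : (Fin k → 𝓜.Num) → Prop) : Prop where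
  exists_form : ∃ θ : Form, IsBounded θ ∧
    ∀ w, θ.Sat 𝓜.toStruct (extend w) 𝓜.set ↔ P w

section Closure

variable {k : ℕ}

instance (i : Fin k) : DefT (fun w : Fin k → 𝓜.Num => w i) :=
  ⟨var i, fun w => by simp [eval, extend]⟩

/-- Countability is used here: beyond index `k`, the assignment `extend w` runs through all numbers,
so each of them is the value of a variable. -/
instance (c : 𝓜.Num) : DefT (fun _ : Fin k → 𝓜.Num => c) := by
  obtain ⟨i, hi⟩ := 𝓜.num_surjective c
  exact ⟨var (i + k), fun w => by simp [eval, extend, hi]⟩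

instance {f g : (Fin k → 𝓜.Num) → 𝓜.Num} [hf : DefT f] [hg : DefT g] :
    DefT (fun w => f w + g w) := by
  obtain ⟨s, hs⟩ := hf
  obtain ⟨t, ht⟩ := hg
  exact ⟨add s t, fun w => by simp only [eval, hs, ht]; rfl⟩

instance {f g : (Fin k → 𝓜.Num) → 𝓜.Num} [hf : DefT f] [hg : DefT g] :
    DefT (fun w => f w * g w) := by
  obtain ⟨s, hs⟩ := hf
  obtain ⟨t, ht⟩ := hg
  exact ⟨mul s t, fun w => by simp only [eval, hs, ht]; rfl⟩

theorem DefB.congr {P Q : (Fin k → 𝓜.Num) → Prop} (hP : DefB P) (h : ∀ w, P w ↔ Q w) :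
    DefB Q := (funext fun w => propext (h w) : P = Q) ▸ hP

instance {f g : (Fin k → 𝓜.Num) → 𝓜.Num} [hf : DefT f] [hg : DefT g] :
    DefB (fun w => f w = g w) := by
  obtain ⟨s, hs⟩ := hf
  obtain ⟨t, ht⟩ := hg
  exact ⟨eq s t, .eq _ _, fun w => by simp [hs, ht]⟩

instance {f g : (Fin k → 𝓜.Num) → 𝓜.Num} [hf : DefT f] [hg : DefT g] :
    DefB (fun w => f w < g w) := by
  obtain ⟨s, hs⟩ := hf
  obtain ⟨t, ht⟩ := hg
  exact ⟨lt s t, .lt _ _, fun w => by simp only [sat_lt, hs, ht]; rfl⟩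

instance {f : (Fin k → 𝓜.Num) → 𝓜.Num} {X : 𝓜.Sets} [hf : DefT f] :
    DefB (fun w => f w ∈ X) := by
  obtain ⟨s, hs⟩ := hf
  obtain ⟨i, rfl⟩ := 𝓜.set_surjective X
  exact ⟨mem s i, .mem _ _, fun w => by simp only [sat_mem, hs]; rfl⟩

instance {P Q : (Fin k → 𝓜.Num) → Prop} [hP : DefB P] [hQ : DefB Q] :
    DefB (fun w => P w → Q w) := by
  obtain ⟨φ, hφ, h⟩ := hP
  obtain ⟨ψ, hψ, h'⟩ := hQ
  exact ⟨imp φ ψ, .imp hφ hψ, fun w => by simp [h, h']⟩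

/-- A statement that does not depend on the tuple, however complex, has a fixed truth value and may
be used as a parameter. -/
instance (p : Prop) : DefB (fun _ : Fin k → 𝓜.Num => p) := by
  by_cases h : p
  · exact ⟨imp falsum falsum, .imp .falsum .falsum, fun w => by simp [h]⟩
  · exact ⟨falsum, .falsum, fun w => by simp [h]⟩

instance {P : (Fin k → 𝓜.Num) → Prop} [DefB P] : DefB (fun w => ¬ P w) :=
  inferInstanceAs (DefB fun w => P w → False)

instance {P Q : (Fin k → 𝓜.Num) → Prop} [DefB P] [DefB Q] : DefB (fun w => P w ∧ Q w) :=
  DefB.congr (inferInstance : DefB fun w => ¬ (P w → ¬ Q w)) fun w => by simp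

instance {P Q : (Fin k → 𝓜.Num) → Prop} [DefB P] [DefB Q] : DefB (fun w => P w ∨ Q w) :=
  DefB.congr (inferInstance : DefB fun w => ¬ P w → Q w) fun _ => or_iff_not_imp_left.symm

instance {P Q : (Fin k → 𝓜.Num) → Prop} [DefB P] [DefB Q] : DefB (fun w => P w ↔ Q w) :=
  DefB.congr (inferInstance : DefB fun w => (P w → Q w) ∧ (Q w → P w))
    fun _ => iff_iff_implies_and_implies.symm

instance {f : (Fin k → 𝓜.Num) → 𝓜.Num} {P : (Fin k → 𝓜.Num) → 𝓜.Num → Prop} [hf : DefT f]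
    [hP : DefB (fun w : Fin (k + 1) → 𝓜.Num => P (fun i => w i.succ) (w 0))] :
    DefB (fun w => ∀ a, a < f w → P w a) := by
  obtain ⟨t, ht⟩ := hf
  obtain ⟨φ, hφ, h⟩ := hP
  refine ⟨ballN t φ, .ballN t hφ, fun w => ?_⟩
  simp only [sat_ballN, ht, ← extend_cons, h, Fin.cons_succ, Fin.cons_zero]
  rfl

instance {f : (Fin k → 𝓜.Num) → 𝓜.Num} {P : (Fin k → 𝓜.Num) → 𝓜.Num → Prop} [hf : DefT f]
    [hP : DefB (fun w : Fin (k + 1) → 𝓜.Num => P (fun i => w i.succ) (w 0))] :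
    DefB (fun w => ∃ a, a < f w ∧ P w a) :=
  DefB.congr (inferInstance : DefB fun w => ¬ ∀ a, a < f w → ¬ P w a) fun w => by simp

theorem DefT.comp {l : ℕ} {f : (Fin k → 𝓜.Num) → 𝓜.Num} (hf : DefT f)
    (g : Fin k → (Fin l → 𝓜.Num) → 𝓜.Num) (hg : ∀ i, DefT (g i)) :
    DefT fun w => f fun i => g i w := by
  obtain ⟨t, ht⟩ := hf
  choose s hs using fun i => (hg i).exists_term
  refine ⟨t.subst fun i => if h : i < k then s ⟨i, h⟩ else var (i - k + l), fun w => ?_⟩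
  rw [eval_subst, ← ht]
  congr 1
  funext i
  simp only [extend]
  split_ifs with h
  · exact hs _ w
  · simp [eval, extend]

theorem DefB.comp {l : ℕ} {P : (Fin k → 𝓜.Num) → Prop} (hP : DefB P)
    (g : Fin k → (Fin l → 𝓜.Num) → 𝓜.Num) (hg : ∀ i, DefT (g i)) :
    DefB fun w => P fun i => g i w := by
  obtain ⟨φ, hφ, h⟩ := hP
  choose s hs using fun i => (hg i).exists_term
  have hsub : ∀ {φ : Form}, IsBounded φ → ∀ σ, IsBounded (φ.substN σ) := by
    intro φ hφ
    induction hφ with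
    | eq s t => exact fun _ => .eq _ _
    | lt s t => exact fun _ => .lt _ _
    | mem t X => exact fun _ => .mem _ _
    | falsum => exact fun _ => .falsum
    | imp _ _ h₁ h₂ => exact fun σ => .imp (h₁ σ) (h₂ σ)
    | ballN t _ h =>
      intro σ
      simp only [Form.ballN, substN, subst_shift]
      exact .ballN _ (h _)
  refine ⟨φ.substN fun i => if h : i < k then s ⟨i, h⟩ else var (i - k + l), hsub hφ _,
    fun w => ?_⟩
  rw [sat_substN, ← h]
  have : (fun i => Term.eval 𝓜.toStruct (extend w)
      (if h : i < k then s ⟨i, h⟩ else var (i - k + l))) = extend fun i => g i w := by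
    funext i
    simp only [extend]
    split_ifs with h
    · exact hs _ w
    · simp [eval, extend]
  rw [this]

end Closure

/-! ### The axioms of `RCA₀` in a model -/

theorem sigma1_induction (P : 𝓜.Num → 𝓜.Num → Prop)
    [hP : DefB fun w : Fin 2 → 𝓜.Num => P (w 0) (w 1)] (h0 : ∃ y, P y 0)
    (hs : ∀ x, (∃ y, P y x) → ∃ y, P y (x + 1)) (x : 𝓜.Num) : ∃ y, P y x := by
  obtain ⟨θ, hθ, h⟩ := hP
  have key := 𝓜.models _ (.sigma1Induction ⟨θ, hθ, rfl⟩) 𝓜.num 𝓜.set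
  have hsat : ∀ x, (exN θ).Sat 𝓜.toStruct (cons x 𝓜.num) 𝓜.set ↔ ∃ y, P y x := fun x => by
    simp only [sat_exN]
    refine exists_congr fun y => ?_
    have : cons y (cons x 𝓜.num) = extend (Fin.cons y (Fin.cons x Fin.elim0)) := by
      rw [extend_cons, extend_cons]
      rfl
    rw [this, h]
    rfl
  rw [inductionAxiom] at key
  simp only [sat_imp, sat_and, sat_allN, instN, instSucc, sat_substN] at key
  refine (hsat x).1 (key ⟨?_, fun a ha => ?_⟩ x)
  · convert (hsat 0).2 h0 with i
    cases i <;> rfl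
  · convert (hsat (a + 1)).2 (hs a ((hsat a).1 ha)) with i
    cases i <;> rfl

theorem bounded_induction (P : 𝓜.Num → Prop) [hP : DefB fun w : Fin 1 → 𝓜.Num => P (w 0)]
    (h0 : P 0) (hs : ∀ x, P x → P (x + 1)) (x : 𝓜.Num) : P x := by
  have : DefB fun w : Fin 2 → 𝓜.Num => P (w 1) := hP.comp (fun _ w => w 1) fun _ => inferInstance
  obtain ⟨-, h⟩ := sigma1_induction (fun _ x => P x) ⟨0, h0⟩ (fun x ⟨_, h⟩ => ⟨0, hs x h⟩) x
  exact h

theorem delta1_comprehension (P Q : 𝓜.Num → 𝓜.Num → Prop)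
    [hP : DefB fun w : Fin 2 → 𝓜.Num => P (w 0) (w 1)]
    [hQ : DefB fun w : Fin 2 → 𝓜.Num => Q (w 0) (w 1)]
    (hPQ : ∀ x, (∃ y, P y x) ↔ ∀ y, Q y x) : ∃ X : 𝓜.Sets, ∀ x, x ∈ X ↔ ∃ y, P y x := by
  obtain ⟨θ, hθ, h⟩ := hP
  obtain ⟨η, hη, h'⟩ := hQ
  have key := 𝓜.models _ (.delta1Comprehension ⟨θ, hθ, rfl⟩ ⟨η, hη, rfl⟩) 𝓜.num 𝓜.set
  have hc : ∀ x y, cons y (cons x 𝓜.num) = extend (Fin.cons y (Fin.cons x Fin.elim0)) :=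
    fun x y => by
      rw [extend_cons, extend_cons]
      rfl
  simp only [comprehensionAxiom, sat_imp, sat_allN, sat_iff, sat_exS, shiftS, sat_renS, sat_exN,
    hc, h, h', cons_succ, sat_mem, cons_zero, eval] at key
  exact key hPQ

theorem bounded_comprehension (P : 𝓜.Num → Prop)
    [hP : DefB fun w : Fin 1 → 𝓜.Num => P (w 0)] : ∃ X : 𝓜.Sets, ∀ x, x ∈ X ↔ P x := by
  have : DefB fun w : Fin 2 → 𝓜.Num => P (w 1) := hP.comp (fun _ w => w 1) fun _ => inferInstance
  obtain ⟨X, hX⟩ := delta1_comprehension (fun _ x => P x) (fun _ x => P x)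
    fun x => ⟨fun ⟨_, h⟩ _ => h, fun h => ⟨0, h 0⟩⟩
  exact ⟨X, fun x => (hX x).trans ⟨fun ⟨_, h⟩ => h, fun h => ⟨0, h⟩⟩⟩

/-! ### Arithmetic in a model -/

namespace Model

theorem succ_ne_zero (a : 𝓜.Num) : a + 1 ≠ 0 :=
  𝓜.models _ (.basic .succ_ne_zero) (cons a 𝓜.num) 𝓜.set

theorem succ_inj {a b : 𝓜.Num} (h : a + 1 = b + 1) : a = b :=
  𝓜.models _ (.basic .succ_inj) (cons a (cons b 𝓜.num)) 𝓜.set h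

theorem add_zero (a : 𝓜.Num) : a + 0 = a :=
  𝓜.models _ (.basic .add_zero) (cons a 𝓜.num) 𝓜.set

theorem add_succ (a b : 𝓜.Num) : a + (b + 1) = a + b + 1 :=
  𝓜.models _ (.basic .add_succ) (cons a (cons b 𝓜.num)) 𝓜.set

theorem mul_zero (a : 𝓜.Num) : a * 0 = 0 :=
  𝓜.models _ (.basic .mul_zero) (cons a 𝓜.num) 𝓜.set

theorem mul_succ (a b : 𝓜.Num) : a * (b + 1) = a * b + a :=
  𝓜.models _ (.basic .mul_succ) (cons a (cons b 𝓜.num)) 𝓜.set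

theorem not_lt_zero (a : 𝓜.Num) : ¬ a < 0 :=
  𝓜.models _ (.basic .not_lt_zero) (cons a 𝓜.num) 𝓜.set

theorem lt_succ {a b : 𝓜.Num} : a < b + 1 ↔ a < b ∨ a = b := by
  have := 𝓜.models _ (.basic .lt_succ) (cons a (cons b 𝓜.num)) 𝓜.set
  simp only [sat_iff, sat_or, sat_lt, sat_eq] at this
  exact this

theorem zero_add (a : 𝓜.Num) : 0 + a = a :=
  bounded_induction (fun a => 0 + a = a) (add_zero 0)
    (fun a h => by rw [add_succ, h]) a

theorem succ_add (a b : 𝓜.Num) : a + 1 + b = a + b + 1 :=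
  bounded_induction (fun b => a + 1 + b = a + b + 1) (by rw [add_zero, add_zero])
    (fun b h => by rw [add_succ, h, add_succ]) b

theorem add_comm (a b : 𝓜.Num) : a + b = b + a :=
  bounded_induction (fun b => a + b = b + a) (by rw [add_zero, zero_add])
    (fun b h => by rw [add_succ, h, succ_add]) b

theorem add_assoc (a b c : 𝓜.Num) : a + b + c = a + (b + c) :=
  bounded_induction (fun c => a + b + c = a + (b + c)) (by rw [add_zero, add_zero])
    (fun c h => by rw [add_succ, add_succ, add_succ, h]) c

theorem zero_mul (a : 𝓜.Num) : 0 * a = 0 :=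
  bounded_induction (fun a => 0 * a = 0) (mul_zero 0)
    (fun a h => by rw [mul_succ, h, add_zero]) a

theorem succ_mul (a b : 𝓜.Num) : (a + 1) * b = a * b + b :=
  bounded_induction (fun b => (a + 1) * b = a * b + b) (by rw [mul_zero, mul_zero, add_zero])
    (fun b h => by
      rw [mul_succ, h, mul_succ, ← add_assoc, ← add_assoc, add_assoc (a * b) b a, add_comm b a,
        ← add_assoc]) b

theorem mul_comm (a b : 𝓜.Num) : a * b = b * a :=
  bounded_induction (fun b => a * b = b * a) (by rw [mul_zero, zero_mul])
    (fun b h => by rw [mul_succ, h, succ_mul]) b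

theorem mul_add (a b c : 𝓜.Num) : a * (b + c) = a * b + a * c :=
  bounded_induction (fun c => a * (b + c) = a * b + a * c) (by rw [add_zero, mul_zero, add_zero])
    (fun c h => by rw [add_succ, mul_succ, h, mul_succ, add_assoc]) c

theorem mul_assoc (a b c : 𝓜.Num) : a * b * c = a * (b * c) :=
  bounded_induction (fun c => a * b * c = a * (b * c)) (by rw [mul_zero, mul_zero, mul_zero])
    (fun c h => by rw [mul_succ, mul_succ, mul_add, h]) c

theorem mul_one (a : 𝓜.Num) : a * 1 = a := by
  rw [← zero_add 1, mul_succ, mul_zero, zero_add]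

/-! ### The ordered semiring of numbers. -/

instance : CommSemiring 𝓜.Num where
  add_assoc := add_assoc
  zero_add := zero_add
  add_zero := add_zero
  add_comm := add_comm
  left_distrib := mul_add
  right_distrib a b c := by rw [mul_comm, mul_add, mul_comm c, mul_comm c]
  zero_mul := zero_mul
  mul_zero := mul_zero
  mul_assoc := mul_assoc
  one_mul a := by rw [mul_comm, mul_one]
  mul_one := mul_one
  mul_comm := mul_comm
  nsmul := nsmulRec
  npow := npowRec

theorem lt_trans {a b c : 𝓜.Num} (hab : a < b) (hbc : b < c) : a < c :=
  bounded_induction (fun c => b < c → a < c) (fun h => (not_lt_zero b h).elim)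
    (fun _ ih h => lt_succ.2 ((lt_succ.1 h).elim (fun h => .inl (ih h)) fun h => .inl (h ▸ hab)))
    c hbc

theorem lt_succ_self (a : 𝓜.Num) : a < a + 1 := lt_succ.2 (.inr rfl)

theorem succ_lt_succ {a b : 𝓜.Num} (h : a < b) : a + 1 < b + 1 :=
  bounded_induction (fun b => a < b → a + 1 < b + 1) (fun h => (not_lt_zero a h).elim)
    (fun _ ih h => (lt_succ.1 h).elim (fun h => lt_trans (ih h) (lt_succ_self _))
      fun h => h ▸ lt_succ_self _) b h

theorem lt_irrefl (a : 𝓜.Num) : ¬ a < a :=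
  bounded_induction (fun a => ¬ a < a) (not_lt_zero 0)
    (fun a ih h => ih ((lt_succ.1 h).elim (lt_trans (lt_succ_self a)) fun h =>
      (congrArg (a < ·) h).mp (lt_succ_self a))) a

theorem pos_or_eq_zero (a : 𝓜.Num) : a = 0 ∨ 0 < a :=
  bounded_induction (fun a => a = 0 ∨ 0 < a) (.inl rfl)
    (fun _ h => .inr (lt_succ.2 (h.symm.imp_right Eq.symm))) a

theorem lt_trichotomy (a b : 𝓜.Num) : a < b ∨ a = b ∨ b < a :=
  bounded_induction (fun b => a < b ∨ a = b ∨ b < a) (.inr (pos_or_eq_zero a))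
    (fun b h => by
      rcases h with h | h | h
      · exact .inl (lt_succ.2 (.inl h))
      · exact .inl (lt_succ.2 (.inr h))
      · exact .inr ((lt_succ.1 (succ_lt_succ h)).symm.imp Eq.symm id)) b

noncomputable instance : LinearOrder 𝓜.Num where
  le a b := a < b ∨ a = b
  lt a b := a < b
  le_refl _ := .inr rfl
  le_trans a b c := by
    rintro (h | rfl) (h' | rfl)
    exacts [.inl (lt_trans h h'), .inl h, .inl h', .inr rfl]
  le_antisymm a b := by
    rintro (h | rfl) (h' | h')
    exacts [(lt_irrefl a (lt_trans h h')).elim, h'.symm, rfl, rfl]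
  le_total a b := by
    rcases lt_trichotomy a b with h | h | h
    exacts [.inl (.inl h), .inl (.inr h), .inr (.inl h)]
  lt_iff_le_not_ge a b := by
    constructor
    · refine fun h => ⟨.inl h, ?_⟩
      rintro (h' | rfl)
      exacts [lt_irrefl a (lt_trans h h'), lt_irrefl _ h]
    · rintro ⟨h | rfl, h'⟩
      exacts [h, (h' (.inr rfl)).elim]
  toDecidableLE := Classical.decRel _

theorem lt_add_one_iff {a b : 𝓜.Num} : a < b + 1 ↔ a ≤ b := lt_succ

theorem add_one_le_iff {a b : 𝓜.Num} : a + 1 ≤ b ↔ a < b := by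
  rw [← not_lt, lt_add_one_iff, not_le]

theorem zero_le (a : 𝓜.Num) : 0 ≤ a := not_lt.1 (not_lt_zero a)

theorem add_lt_add_right {a b : 𝓜.Num} (h : a < b) (c : 𝓜.Num) : a + c < b + c :=
  bounded_induction (fun c => a + c < b + c) (by rwa [add_zero, add_zero])
    (fun c ih => by rw [add_succ, add_succ]; exact succ_lt_succ ih) c

theorem exists_add_of_le {a b : 𝓜.Num} (h : a ≤ b) : ∃ c, b = a + c := by
  have : DefB fun w : Fin 2 → 𝓜.Num => w 1 < a ∨ w 1 = a + w 0 := inferInstance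
  obtain ⟨c, hc⟩ := sigma1_induction (fun c b => b < a ∨ b = a + c)
    ⟨0, (pos_or_eq_zero a).symm.imp id fun h => by rw [h, add_zero]⟩
    (fun b ⟨c, h⟩ => by
      rcases h with h | rfl
      · rcases lt_succ.1 (succ_lt_succ h) with h | h
        exacts [⟨0, .inl h⟩, ⟨0, .inr (by rw [h, add_zero])⟩]
      · exact ⟨c + 1, .inr (add_assoc a c 1)⟩) b
  exact ⟨c, hc.resolve_left h.not_gt⟩

instance : IsOrderedAddMonoid 𝓜.Num where
  add_le_add_left a b h c := by
    rcases h with h | rfl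
    exacts [.inl (add_lt_add_right h c), .inr rfl]

instance : CanonicallyOrderedAdd 𝓜.Num where
  exists_add_of_le := exists_add_of_le
  le_self_add a b := by
    simpa only [add_zero] using add_le_add_right (zero_le b) a
  le_add_self a b := by
    simpa only [zero_add] using add_le_add_left (zero_le b) a

instance : IsOrderedCancelAddMonoid 𝓜.Num where
  le_of_add_le_add_left a b c h :=
    not_lt.1 fun h' => (add_lt_add_right h' a).not_ge (by rwa [add_comm b, add_comm c])

instance : Nontrivial 𝓜.Num := ⟨⟨0, 1, fun h => succ_ne_zero (0 : 𝓜.Num) (by rw [zero_add, h])⟩⟩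

theorem one_le_of_pos {a : 𝓜.Num} (h : 0 < a) : 1 ≤ a := by
  simpa only [zero_add] using add_one_le_iff.2 h

theorem mul_lt_mul_right {a b c : 𝓜.Num} (h : a < b) (hc : 0 < c) : a * c < b * c := by
  obtain ⟨d, rfl⟩ := exists_add_of_le (one_le_of_pos hc)
  refine bounded_induction (fun d => a * (1 + d) < b * (1 + d)) ?_ (fun d ih => ?_) d
  · rwa [add_zero, mul_one, mul_one]
  · rw [← add_assoc, mul_succ, mul_succ]
    exact add_lt_add ih h

instance : IsStrictOrderedRing 𝓜.Num where
  zero_le_one := zero_le 1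
  mul_lt_mul_of_pos_left a ha b c h := by
    rw [mul_comm a, mul_comm a]
    exact mul_lt_mul_right h ha
  mul_lt_mul_of_pos_right a ha b c h := mul_lt_mul_right h ha

end Model

instance {k : ℕ} {f : (Fin k → 𝓜.Num) → 𝓜.Num} {P : (Fin k → 𝓜.Num) → 𝓜.Num → Prop} [DefT f]
    [DefB (fun w : Fin (k + 1) → 𝓜.Num => P (fun i => w i.succ) (w 0))] :
    DefB (fun w => ∃ a, a ≤ f w ∧ P w a) :=
  DefB.congr (inferInstance : DefB fun w => ∃ a, a < f w + 1 ∧ P w a)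
    fun w => by simp only [Model.lt_add_one_iff]

/-- The quotient can be bounded by `g w`; when `f w = 0` the quotient `0` serves. -/
instance {k : ℕ} {f g : (Fin k → 𝓜.Num) → 𝓜.Num} [hf : DefT f] [hg : DefT g] :
    DefB (fun w => f w ∣ g w) := by
  have : DefT fun w : Fin (k + 1) → 𝓜.Num => f fun i => w i.succ :=
    hf.comp (fun i w => w i.succ) fun _ => inferInstance
  have : DefT fun w : Fin (k + 1) → 𝓜.Num => g fun i => w i.succ :=
    hg.comp (fun i w => w i.succ) fun _ => inferInstance
  refine DefB.congr (inferInstance : DefB fun w => ∃ c, c ≤ g w ∧ g w = f w * c) fun w => ?_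
  refine ⟨fun ⟨c, _, h⟩ => ⟨c, h⟩, fun ⟨c, h⟩ => ?_⟩
  rcases Model.pos_or_eq_zero (f w) with h0 | h0
  · exact ⟨0, Model.zero_le _, by rw [h, h0, zero_mul, zero_mul]⟩
  · exact ⟨c, h ▸ le_mul_of_one_le_left (Model.zero_le _) (Model.one_le_of_pos h0), h⟩

namespace Model

/-! ### Pairs -/

/-- The code of an ordered pair. -/
def pair (a b : 𝓜.Num) : 𝓜.Num := (a + b) * (a + b) + a

instance {k : ℕ} {f g : (Fin k → 𝓜.Num) → 𝓜.Num} [DefT f] [DefT g] :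
    DefT (fun w => pair (f w) (g w)) :=
  (inferInstance : DefT fun w => (f w + g w) * (f w + g w) + f w)

theorem le_pair_left (a b : 𝓜.Num) : a ≤ pair a b := le_add_self

theorem le_mul_self (a : 𝓜.Num) : a ≤ a * a := by
  rcases pos_or_eq_zero a with rfl | h
  · exact zero_le _
  · exact le_mul_of_one_le_left (zero_le a) (one_le_of_pos h)

theorem le_pair_right (a b : 𝓜.Num) : b ≤ pair a b :=
  (le_add_self.trans (le_mul_self (a + b))).trans le_self_add

/-- Pairs with sum `s` have codes from `s²` to `s² + s`, all below `(s + 1)²`. -/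
theorem pair_lt_pair {a b c d : 𝓜.Num} (h : a + b < c + d) : pair a b < pair c d := by
  have h₁ : pair a b < (a + b + 1) * (a + b + 1) := by
    have : (a + b + 1) * (a + b + 1) = pair a b + (a + b + b + 1) := by
      unfold pair
      ring
    rw [this]
    exact lt_add_of_pos_right _ (add_pos_of_nonneg_of_pos (zero_le _) one_pos)
  have h₂ := add_one_le_iff.2 h
  exact (h₁.trans_le (mul_le_mul h₂ h₂ (zero_le _) (zero_le _))).trans_le le_self_add

theorem pair_inj {a b c d : 𝓜.Num} : pair a b = pair c d ↔ a = c ∧ b = d := by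
  refine ⟨fun h => ?_, fun ⟨h, h'⟩ => h ▸ h' ▸ rfl⟩
  rcases lt_trichotomy (a + b) (c + d) with hs | hs | hs
  · exact absurd h (pair_lt_pair hs).ne
  · unfold pair at h
    rw [hs] at h
    obtain rfl := add_left_cancel h
    exact ⟨rfl, add_left_cancel hs⟩
  · exact absurd h (pair_lt_pair hs).ne'

theorem _root_.SecondOrderArith.DefB.comp₂ {P : 𝓜.Num → 𝓜.Num → Prop}
    (hP : DefB fun w : Fin 2 → 𝓜.Num => P (w 0) (w 1)) {k : ℕ}
    (f g : (Fin k → 𝓜.Num) → 𝓜.Num) [hf : DefT f] [hg : DefT g] :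
    DefB fun w => P (f w) (g w) :=
  hP.comp (fun i w => if i = 0 then f w else g w) fun i => by
    split_ifs
    exacts [hf, hg]

/-- Lets a bounded relation be replaced by a set of codes, hence by an atomic formula. -/
theorem exists_relation (P : 𝓜.Num → 𝓜.Num → Prop)
    [hP : DefB fun w : Fin 2 → 𝓜.Num => P (w 0) (w 1)] :
    ∃ X : 𝓜.Sets, ∀ x y, pair x y ∈ X ↔ P x y := by
  have := @hP.comp₂
  obtain ⟨X, hX⟩ := bounded_comprehension fun z : 𝓜.Num =>
    ∃ x, x ≤ z ∧ ∃ y, y ≤ z ∧ z = pair x y ∧ P x y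
  refine ⟨X, fun x y => (hX _).trans ⟨?_, fun h =>
    ⟨x, le_pair_left x y, y, le_pair_right x y, rfl, h⟩⟩⟩
  rintro ⟨a, -, b, -, h, hP⟩
  obtain ⟨rfl, rfl⟩ := pair_inj.1 h
  exact hP

/-! ### Minimization and bounding -/

/-- The least number principle for `Π⁰₁` predicates. -/
theorem exists_least (P : 𝓜.Num → 𝓜.Num → Prop)
    [DefB fun w : Fin 2 → 𝓜.Num => P (w 0) (w 1)] {a : 𝓜.Num} (ha : ∀ t, P t a) :
    ∃ a, (∀ t, P t a) ∧ ∀ b, (∀ t, P t b) → a ≤ b := by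
  obtain ⟨X, hX⟩ := exists_relation P
  simp only [← hX] at ha ⊢
  by_contra! hcon
  -- Without a least solution, induction shows that all `y < z` have counterexamples below a common
  -- bound `c`; the common bound is what makes the induction hypothesis `Σ⁰₁`.
  obtain ⟨c, hc⟩ := sigma1_induction
    (fun c z => ∀ y, y < z → ∃ t, t < c ∧ ¬ pair t y ∈ X)
    ⟨0, fun y h => (not_lt_zero y h).elim⟩ (fun z ⟨c, hc⟩ => by
      have hz : ∃ t, ¬ pair t z ∈ X := by
        by_contra! h
        obtain ⟨b, hb, hbz⟩ := hcon z h
        obtain ⟨t, -, ht⟩ := hc b hbz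
        exact ht (hb t)
      obtain ⟨s, hs⟩ := hz
      refine ⟨max c (s + 1), fun y hy => ?_⟩
      rcases lt_succ.1 hy with hy | rfl
      · obtain ⟨t, ht, h⟩ := hc y hy
        exact ⟨t, lt_max_of_lt_left ht, h⟩
      · exact ⟨s, lt_max_of_lt_right (lt_succ_self s), hs⟩) (a + 1)
  obtain ⟨t, -, ht⟩ := hc a (lt_succ_self a)
  exact ht (ha t)

/-- `Σ⁰₁` bounding. -/
theorem exists_bound (P : 𝓜.Num → 𝓜.Num → Prop)
    [DefB fun w : Fin 2 → 𝓜.Num => P (w 0) (w 1)] (x : 𝓜.Num) (hx : ∀ u, u < x → ∃ t, P u t) :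
    ∃ b, ∀ u, u < x → ∃ t, t < b ∧ P u t := by
  obtain ⟨X, hX⟩ := exists_relation P
  simp only [← hX] at hx ⊢
  obtain ⟨b, hb⟩ := sigma1_induction
    (fun b z => ∀ u, u < z → u < x → ∃ t, t < b ∧ pair u t ∈ X)
    ⟨0, fun y h => (not_lt_zero y h).elim⟩ (fun z ⟨b, hb⟩ => by
      by_cases hz : z < x
      · obtain ⟨s, hs⟩ := hx z hz
        refine ⟨max b (s + 1), fun u hu hux => ?_⟩
        rcases lt_succ.1 hu with hu | rfl
        · obtain ⟨t, ht, h⟩ := hb u hu hux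
          exact ⟨t, lt_max_of_lt_left ht, h⟩
        · exact ⟨s, lt_max_of_lt_right (lt_succ_self s), hs⟩
      · refine ⟨b, fun u hu hux => ?_⟩
        rcases lt_succ.1 hu with hu | rfl
        exacts [hb u hu hux, (hz hux).elim]) x
  exact ⟨b, fun u hu => hb u hu hu⟩

/-! ### Divisibility and codes of finite sets. -/

theorem dvd_of_dvd_add {a b c : 𝓜.Num} (h : a ∣ b + c) (hb : a ∣ b) : a ∣ c := by
  obtain ⟨x, rfl⟩ := hb
  obtain ⟨y, hy⟩ := h
  rcases le_total x y with hxy | hxy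
  · obtain ⟨z, rfl⟩ := exists_add_of_le hxy
    rw [mul_add] at hy
    exact ⟨z, add_left_cancel hy⟩
  · have : a * x + c ≤ a * x + 0 := by
      rw [hy, add_zero]
      exact mul_le_mul_of_nonneg_left hxy (zero_le a)
    rw [le_antisymm (le_of_add_le_add_left this) (zero_le c)]
    exact dvd_zero a

theorem exists_common_multiple (x : 𝓜.Num) : ∃ m, 0 < m ∧ ∀ i, i < x → i + 1 ∣ m :=
  sigma1_induction (fun m x => 0 < m ∧ ∀ i, i < x → i + 1 ∣ m)
    ⟨1, one_pos, fun i h => (not_lt_zero i h).elim⟩ (fun x ⟨m, hm, h⟩ =>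
      ⟨m * (x + 1), mul_pos hm (lt_add_one_iff.2 (zero_le x)), fun i hi => by
        rcases lt_succ.1 hi with hi | rfl
        exacts [(h i hi).mul_right _, dvd_mul_left _ _]⟩) x

/-- The moduli `(u + 1) * m + 1` for `u < x` are pairwise coprime if `1, …, x` divide `m`. -/
theorem dvd_of_dvd_modulus_mul {x m u v d : 𝓜.Num} (hm : ∀ i, i < x → i + 1 ∣ m) (hu : u < x)
    (hv : v < x) (huv : u ≠ v) (h : (u + 1) * m + 1 ∣ ((v + 1) * m + 1) * d) :
    (u + 1) * m + 1 ∣ d := by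
  -- The modulus is coprime to `m`, because `(u + 1) * (c * m) + c = ((u + 1) * m + 1) * c`.
  have hcancel : ∀ c, (u + 1) * m + 1 ∣ c * m → (u + 1) * m + 1 ∣ c := fun c hc => by
    refine dvd_of_dvd_add (b := (u + 1) * (c * m)) ?_ (hc.mul_left _)
    exact ⟨c, by ring⟩
  -- After cancelling `m`, the factor `k + 1` is completed to `m` by its cofactor and cancelled in
  -- the same way.
  have hcancel' : ∀ k c, k < x → (u + 1) * m + 1 ∣ c * (k + 1) * m → (u + 1) * m + 1 ∣ c := by
    intro k c hk hc
    obtain ⟨e, he⟩ := hm k hk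
    refine hcancel c ?_
    have := (hcancel _ hc).mul_right e
    rwa [mul_assoc, ← he] at this
  -- The two moduli differ by `(k + 1) * m` for some `k < x`, so the modulus of `u` divides `d * (k
  -- + 1) * m`.
  rcases lt_trichotomy u v with h' | h' | h'
  · obtain ⟨k, rfl⟩ := exists_add_of_le (add_one_le_iff.2 h')
    refine hcancel' k d (lt_of_le_of_lt le_add_self hv) ?_
    refine dvd_of_dvd_add (b := ((u + 1) * m + 1) * d) ?_ (dvd_mul_right _ _)
    convert h using 1
    ring
  · exact absurd h' huv
  · obtain ⟨k, rfl⟩ := exists_add_of_le (add_one_le_iff.2 h')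
    refine hcancel' k d (lt_of_le_of_lt le_add_self hu) ?_
    refine dvd_of_dvd_add (b := ((v + 1) * m + 1) * d) ⟨d, ?_⟩ h
    ring

/-- Bounded `Σ⁰₁` comprehension, with finite sets coded by divisibility. -/
theorem exists_code (X : 𝓜.Sets) (x : 𝓜.Num) :
    ∃ m d : 𝓜.Num, ∀ u, u < x → ((u + 1) * m + 1 ∣ d ↔ ∃ t, pair u t ∈ X) := by
  obtain ⟨m, hm0, hm⟩ := exists_common_multiple x
  obtain ⟨D, hD, hDu⟩ := exists_common_multiple ((x + 1) * m + 1)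
  -- The code `d` is the least positive common multiple of the moduli of the elements to be coded.
  -- Being such a multiple is a `Π⁰₁` condition, and `D` shows that it can be met.
  obtain ⟨d, hd, hmin⟩ := exists_least (a := D)
    (fun t d => 0 < d ∧ ∀ u, u < x → pair u t ∈ X → (u + 1) * m + 1 ∣ d)
    fun t => ⟨hD, fun u hu _ => hDu _ (lt_add_one_iff.2
      (mul_le_mul_of_nonneg_right (add_le_add_left hu.le 1) (zero_le m)))⟩
  refine ⟨m, d, fun u hu => ⟨fun hdvd => ?_, fun ⟨t, ht⟩ => (hd t).2 u hu ht⟩⟩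
  -- If `u` is not to be coded but its modulus divides `d`, the cofactor `e` is by coprimality a
  -- smaller common multiple.
  by_contra! hcon
  obtain ⟨e, rfl⟩ := hdvd
  have hpos := (hd 0).1
  have he : 0 < e := (pos_or_eq_zero e).resolve_left fun h => by
    rw [h, mul_zero] at hpos
    exact lt_irrefl _ hpos
  have hle := hmin e fun t => ⟨he, fun v hv hvt => by
    refine dvd_of_dvd_modulus_mul hm hv hu ?_ ((hd t).2 v hv hvt)
    rintro rfl
    exact hcon t hvt⟩
  rw [add_mul, one_mul] at hle
  exact hle.not_gt (lt_add_of_pos_left e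
    (mul_pos (mul_pos (lt_add_one_iff.2 (zero_le u)) hm0) he))

/-- Strong `Σ⁰₁` bounding. -/
theorem exists_strong_bound (X : 𝓜.Sets) (x : 𝓜.Num) :
    ∃ b, ∀ u, u < x → ∀ t, pair u t ∈ X → ∃ s, s < b ∧ pair u s ∈ X := by
  obtain ⟨m, d, h⟩ := exists_code X x
  -- With divisibility in place of the `Σ⁰₁` premise, the implication is bounded and always has a
  -- witness, so ordinary bounding applies.
  obtain ⟨b, hb⟩ := exists_bound (fun u t => (u + 1) * m + 1 ∣ d → pair u t ∈ X) x
    fun u hu => by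
      by_cases hdvd : (u + 1) * m + 1 ∣ d
      · obtain ⟨t, ht⟩ := (h u hu).1 hdvd
        exact ⟨t, fun _ => ht⟩
      · exact ⟨0, fun h => absurd h hdvd⟩
  refine ⟨b, fun u hu t ht => ?_⟩
  obtain ⟨s, hs, h'⟩ := hb u hu
  exact ⟨s, hs, h' ((h u hu).2 ⟨t, ht⟩)⟩

end Model

/-! ### From `Σ⁰₁` comprehension to arithmetical comprehension -/

/-- `Σ⁰₁` comprehension. -/
def Model.Sigma1Comprehension (𝓜 : Model) : Prop :=
  ∀ X : 𝓜.Sets, ∃ Y : 𝓜.Sets, ∀ x, x ∈ Y ↔ ∃ t, Model.pair x t ∈ X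

open Model

/-- With one free variable, the set given by `Σ⁰₁` comprehension becomes a parameter that replaces
the quantifier. With none there is only a truth value; with more, two variables are merged into a
pair. -/
theorem DefB.exists_of_sigma1Comprehension (h𝓜 : 𝓜.Sigma1Comprehension) (k : ℕ) :
    ∀ P : 𝓜.Num → (Fin k → 𝓜.Num) → Prop,
      DefB (fun w : Fin (k + 1) → 𝓜.Num => P (w 0) fun i => w i.succ) →
      DefB fun w : Fin k → 𝓜.Num => ∃ a, P a w := by
  induction k with
  | zero =>
    intro P _
    exact DefB.congr (inferInstance : DefB fun _ => ∃ a, P a Fin.elim0)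
      fun w => by rw [Subsingleton.elim w]
  | succ k ih =>
    cases k with
    | zero =>
      intro P hP
      have : DefB fun w : Fin 2 → 𝓜.Num => P (w 1) fun _ => w 0 :=
        (hP.comp (fun i w => w i.rev) fun _ => inferInstance).congr fun w => by
          refine iff_of_eq (congrArg (P (w 1)) (funext fun i => ?_))
          fin_cases i
          rfl
      obtain ⟨X, hX⟩ := exists_relation fun x a => P a fun _ => x
      obtain ⟨Y, hY⟩ := h𝓜 X
      refine DefB.congr (inferInstance : DefB fun w => w 0 ∈ Y) fun w => ?_
      simp only [hY, hX]
      rw [show (fun _ => w 0) = w from funext fun i => by fin_cases i; rfl]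
    | succ k =>
      intro P hP
      have hdef : DefB fun w : Fin (k + 1 + 1 + 1 + 1) → 𝓜.Num =>
          P (w (Fin.succ (Fin.succ 0))) (Fin.cons (w (Fin.succ 0)) (Fin.cons (w 0)
            fun i => w i.succ.succ.succ.succ)) := by
        refine (hP.comp (fun i w => w ((Fin.cons (Fin.succ (Fin.succ 0)) (Fin.cons (Fin.succ 0)
          (Fin.cons 0 fun i => i.succ.succ.succ.succ)) :
            Fin (k + 3) → Fin (k + 4)) i)) fun _ => inferInstance).congr fun w => ?_
        refine iff_of_eq (congrArg _ (funext fun i => ?_))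
        refine Fin.cases rfl (fun i => ?_) i
        refine Fin.cases rfl (fun i => ?_) i
        rfl
      have key := ih (fun a w => ∃ x, x ≤ w 0 ∧ ∃ y, y ≤ w 0 ∧ w 0 = pair x y ∧
        P a (Fin.cons x (Fin.cons y fun i => w i.succ))) inferInstance
      refine (key.comp (fun i w => (Fin.cons (pair (w 0) (w (Fin.succ 0)))
        (fun i => w i.succ.succ) : Fin (k + 1) → 𝓜.Num) i) fun i => ?_).congr fun w => ?_
      · refine Fin.cases (inferInstance : DefT fun w : Fin (k + 2) → 𝓜.Num =>
          pair (w 0) (w (Fin.succ 0))) (fun i => ?_) i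
        exact (inferInstance : DefT fun w : Fin (k + 2) → 𝓜.Num => w i.succ.succ)
      · refine exists_congr fun a => ?_
        have hw : w = Fin.cons (w 0) (Fin.cons (w (Fin.succ 0)) fun i => w i.succ.succ) := by
          refine funext fun i => Fin.cases rfl (fun i => ?_) i
          exact Fin.cases rfl (fun i => rfl) i
        simp only [Fin.cons_zero, Fin.cons_succ]
        constructor
        · rintro ⟨x, -, y, -, h, hP⟩
          obtain ⟨rfl, rfl⟩ := pair_inj.1 h
          rwa [hw]
        · intro hP
          rw [hw] at hP
          exact ⟨_, le_pair_left _ _, _, le_pair_right _ _, rfl, hP⟩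

theorem DefT.eval {k : ℕ} {τ : ℕ → (Fin k → 𝓜.Num) → 𝓜.Num} (hτ : ∀ i, DefT (τ i)) (t : Term) :
    DefT fun w => t.eval 𝓜.toStruct fun i => τ i w := by
  induction t with
  | var i => exact hτ i
  | zero => exact (inferInstance : DefT fun _ : Fin k → 𝓜.Num => (0 : 𝓜.Num))
  | one => exact (inferInstance : DefT fun _ : Fin k → 𝓜.Num => (1 : 𝓜.Num))
  | add s t hs ht =>
    exact (inferInstance : DefT fun w => (s.eval 𝓜.toStruct fun i => τ i w) +
      (t.eval 𝓜.toStruct fun i => τ i w : 𝓜.Num))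
  | mul s t hs ht =>
    exact (inferInstance : DefT fun w => (s.eval 𝓜.toStruct fun i => τ i w) *
      (t.eval 𝓜.toStruct fun i => τ i w : 𝓜.Num))

/-- Each quantifier is removed by `DefB.exists_of_sigma1Comprehension`. The assignment `τ` is
arbitrary so that a quantified variable can become a new coordinate of the tuple. -/
theorem DefB.sat_of_isArithmetical (h𝓜 : 𝓜.Sigma1Comprehension) {φ : Form}
    (hφ : IsArithmetical φ) (e : ℕ → 𝓜.Sets) :
    ∀ {k : ℕ} (τ : ℕ → (Fin k → 𝓜.Num) → 𝓜.Num), (∀ i, DefT (τ i)) →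
      DefB fun w => φ.Sat 𝓜.toStruct (fun i => τ i w) e := by
  induction hφ with
  | eq s t =>
    intro k τ hτ
    have := DefT.eval hτ s
    have := DefT.eval hτ t
    exact (inferInstance : DefB fun w => (s.eval 𝓜.toStruct fun i => τ i w) =
      (t.eval 𝓜.toStruct fun i => τ i w : 𝓜.Num))
  | lt s t =>
    intro k τ hτ
    have := DefT.eval hτ s
    have := DefT.eval hτ t
    exact (inferInstance : DefB fun w => (s.eval 𝓜.toStruct fun i => τ i w) <
      (t.eval 𝓜.toStruct fun i => τ i w : 𝓜.Num))
  | mem t X =>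
    intro k τ hτ
    have := DefT.eval hτ t
    exact (inferInstance : DefB fun w =>
      (t.eval 𝓜.toStruct fun i => τ i w : 𝓜.Num) ∈ (e X : 𝓜.Sets))
  | falsum => exact fun _ _ => (inferInstance : DefB fun _ => False)
  | @imp φ ψ _ _ h₁ h₂ =>
    intro k τ hτ
    have := h₁ τ hτ
    have := h₂ τ hτ
    exact (inferInstance : DefB fun w => φ.Sat 𝓜.toStruct (fun i => τ i w) e →
      ψ.Sat 𝓜.toStruct (fun i => τ i w) e)
  | @allN φ _ ih =>
    intro k τ hτ
    have h := ih (k := k + 1) (fun i w => cons (w 0) (fun i => τ i fun i => w i.succ) i) fun i => by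
      cases i with
      | zero => exact (inferInstance : DefT fun w : Fin (k + 1) → 𝓜.Num => w 0)
      | succ i => exact (hτ i).comp (fun i w => w i.succ) fun _ => inferInstance
    have := DefB.exists_of_sigma1Comprehension h𝓜 k
      (fun a w => ¬ φ.Sat 𝓜.toStruct (cons a fun i => τ i w) e) inferInstance
    exact DefB.congr (inferInstance : DefB fun w =>
      ¬ ∃ a, ¬ φ.Sat 𝓜.toStruct (cons a fun i => τ i w) e) fun w => by simp

theorem Model.Sigma1Comprehension.sat_comprehensionAxiom (h𝓜 : 𝓜.Sigma1Comprehension) {φ : Form}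
    (hφ : IsArithmetical φ) (v : ℕ → 𝓜.Num) (e : ℕ → 𝓜.Sets) :
    (comprehensionAxiom φ).Sat 𝓜.toStruct v e := by
  have := DefB.sat_of_isArithmetical h𝓜 hφ e (k := 1) (fun i w => cons (w 0) v i) fun i => by
    cases i with
    | zero => exact (inferInstance : DefT fun w : Fin 1 → 𝓜.Num => w 0)
    | succ i => exact (inferInstance : DefT fun _ : Fin 1 → 𝓜.Num => v i)
  obtain ⟨X, hX⟩ := bounded_comprehension fun x => φ.Sat 𝓜.toStruct (cons x v) e
  simp only [comprehensionAxiom, sat_exS, sat_allN, sat_iff, shiftS, sat_renS, cons_succ, sat_mem,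
    cons_zero, Term.eval]
  exact ⟨X, hX⟩

namespace Model

/-! ### Changes of the approximations to a `Σ⁰₁` set -/

/-- Some `u < x` satisfies `∃ t, (u, t) ∈ X` with a witness below `z` but none below `y`. -/
def Change (X : 𝓜.Sets) (x y z : 𝓜.Num) : Prop :=
  ∃ u, u < x ∧ (∃ t, t < z ∧ pair u t ∈ X) ∧ ¬ ∃ t, t < y ∧ pair u t ∈ X

theorem defB_change (X : 𝓜.Sets) :
    DefB fun w : Fin 3 → 𝓜.Num => Change X (w 0) (w 1) (w 2) := by
  unfold Change
  infer_instance

instance {k : ℕ} (X : 𝓜.Sets) (f g h : (Fin k → 𝓜.Num) → 𝓜.Num) [DefT f] [DefT g] [DefT h] :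
    DefB fun w => Change X (f w) (g w) (h w) :=
  (defB_change X).comp ![f, g, h] fun i => by
    fin_cases i <;> simpa

theorem Change.mono {X : 𝓜.Sets} {x y z z' : 𝓜.Num} (h : Change X x y z) (hz : z ≤ z') :
    Change X x y z' := by
  obtain ⟨u, hu, ⟨t, ht, hX⟩, h⟩ := h
  exact ⟨u, hu, ⟨t, ht.trans_le hz, hX⟩, h⟩

theorem change_eventually_const (X : 𝓜.Sets) (x y : 𝓜.Num) :
    ∃ b, ∀ z, b ≤ z → (Change X x y z ↔ ∃ z', Change X x y z') := by
  by_cases h : ∃ z, Change X x y z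
  · obtain ⟨b, hb⟩ := h
    exact ⟨b, fun z hz => ⟨fun h => ⟨z, h⟩, fun _ => hb.mono hz⟩⟩
  · exact ⟨0, fun z _ => ⟨fun h => ⟨z, h⟩, fun h' => absurd h' h⟩⟩

/-- By strong bounding, from some stage on every `u < x` that ever receives a witness already has
one. -/
theorem eventually_not_change (X : 𝓜.Sets) (x : 𝓜.Num) :
    ∃ b, ∀ y, b ≤ y → ¬ ∃ z, Change X x y z := by
  obtain ⟨b, hb⟩ := exists_strong_bound X x
  refine ⟨b, ?_⟩
  rintro y hy ⟨z, u, hu, ⟨t, -, ht⟩, h⟩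
  obtain ⟨s, hs, hX⟩ := hb u hu t ht
  exact h ⟨s, hs.trans_le hy, hX⟩

theorem exists_iff_of_not_change {X : 𝓜.Sets} {x y u : 𝓜.Num} (h : ¬ ∃ z, Change X x y z)
    (hu : u < x) : (∃ t, t < y ∧ pair u t ∈ X) ↔ ∃ t, pair u t ∈ X := by
  refine ⟨fun ⟨t, _, ht⟩ => ⟨t, ht⟩, fun ⟨t, ht⟩ => ?_⟩
  by_contra hcon
  exact h ⟨t + 1, u, hu, ⟨t, lt_succ_self t, ht⟩, hcon⟩

/-! ### Increasing tuples with a prescribed pattern of changes -/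

/-- `H` contains `x₀ < ⋯ < x_j = y < x_{j+1} = z` for which `Change X xᵢ xᵢ₊₁ xᵢ₊₂` has the truth
value `γ i`, for all `i < j`. -/
def Chain (X H : 𝓜.Sets) (γ : ℕ → Prop) : ℕ → 𝓜.Num → 𝓜.Num → Prop
  | 0, y, z => y < z ∧ y ∈ H ∧ z ∈ H
  | j + 1, y, z => y < z ∧ z ∈ H ∧ ∃ x, x < y ∧ Chain X H γ j x y ∧ (Change X x y z ↔ γ j)

/-- `Chain X H γ j y z` for all large `z` in `H`. -/
def LimChain (X H : 𝓜.Sets) (γ : ℕ → Prop) : ℕ → 𝓜.Num → Prop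
  | 0, y => y ∈ H
  | j + 1, y => ∃ x, x < y ∧ Chain X H γ j x y ∧ ((∃ z, Change X x y z) ↔ γ j)

theorem defB_chain (X H : 𝓜.Sets) (γ : ℕ → Prop) (j : ℕ) :
    DefB fun w : Fin 2 → 𝓜.Num => Chain X H γ j (w 0) (w 1) := by
  induction j with
  | zero => exact (inferInstance : DefB fun w : Fin 2 → 𝓜.Num => w 0 < w 1 ∧ w 0 ∈ H ∧ w 1 ∈ H)
  | succ j ih =>
    have := @ih.comp₂
    exact (inferInstance : DefB fun w : Fin 2 → 𝓜.Num => w 0 < w 1 ∧ w 1 ∈ H ∧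
      ∃ x, x < w 0 ∧ Chain X H γ j x (w 0) ∧ (Change X x (w 0) (w 1) ↔ γ j))

theorem Chain.exists_tuple {X H : 𝓜.Sets} {γ : ℕ → Prop} {j : ℕ} :
    ∀ {y z : 𝓜.Num}, Chain X H γ j y z → ∃ x : ℕ → 𝓜.Num, x j = y ∧ x (j + 1) = z ∧
      (∀ i < j + 1, x i < x (i + 1)) ∧ (∀ i < j + 2, x i ∈ H) ∧
      ∀ i < j, (Change X (x i) (x (i + 1)) (x (i + 2)) ↔ γ i) := by
  induction j with
  | zero =>
    rintro y z ⟨hyz, hy, hz⟩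
    refine ⟨fun i => if i = 0 then y else z, rfl, rfl, fun i hi => ?_, fun i _ => ?_,
      fun i hi => absurd hi (Nat.not_lt_zero i)⟩
    · obtain rfl : i = 0 := by omega
      exact hyz
    · dsimp only
      split_ifs
      exacts [hy, hz]
  | succ j ih =>
    rintro y z ⟨hyz, hz, a, -, h, hγ⟩
    obtain ⟨x, rfl, rfl, hx, hH, hxγ⟩ := ih h
    obtain ⟨x', hle, rfl⟩ : ∃ x' : ℕ → 𝓜.Num, (∀ i ≤ j + 1, x' i = x i) ∧ x' (j + 2) = z :=
      ⟨fun i => if i ≤ j + 1 then x i else z, fun i hi => if_pos hi, if_neg (by omega)⟩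
    refine ⟨x', hle _ le_rfl, rfl, fun i hi => ?_, fun i hi => ?_, fun i hi => ?_⟩
    · rcases Nat.lt_succ_iff_lt_or_eq.1 hi with hi | rfl
      · rw [hle i hi.le, hle (i + 1) hi]
        exact hx i hi
      · rwa [hle _ le_rfl]
    · rcases Nat.lt_succ_iff_lt_or_eq.1 hi with hi | rfl
      · rw [hle i (Nat.lt_succ_iff.1 hi)]
        exact hH i hi
      · exact hz
    · rcases Nat.lt_succ_iff_lt_or_eq.1 hi with hi | rfl
      · rw [hle i (by omega), hle (i + 1) (by omega), hle (i + 2) (by omega)]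
        exact hxγ i hi
      · rwa [hle _ (by omega), hle _ le_rfl]

theorem LimChain.eventually_chain {X H : 𝓜.Sets} {γ : ℕ → Prop} {j : ℕ} {y : 𝓜.Num}
    (h : LimChain X H γ j y) : ∃ b, ∀ z, b ≤ z → y < z → z ∈ H → Chain X H γ j y z := by
  cases j with
  | zero => exact ⟨0, fun z _ hyz hz => ⟨hyz, h, hz⟩⟩
  | succ j =>
    obtain ⟨x, hx, hch, hγ⟩ := h
    obtain ⟨b, hb⟩ := change_eventually_const X x y
    exact ⟨b, fun z hbz hyz hz => ⟨hyz, hz, x, hx, hch, (hb z hbz).trans hγ⟩⟩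

/-- If an infinite set omits a pattern of changes, then the `Σ⁰₁` set given by `X` exists. -/
theorem exists_sigma1_of_not_chain {X H : 𝓜.Sets} {γ : ℕ → Prop} {n : ℕ}
    (hH : ∀ b, ∃ x, b < x ∧ x ∈ H) (hγ : ∀ y z, ¬ Chain X H γ n y z) :
    ∃ Y : 𝓜.Sets, ∀ u, u ∈ Y ↔ ∃ t, pair u t ∈ X := by
  have hlim : ∀ {j : ℕ} {y : 𝓜.Num}, LimChain X H γ j y → ∀ b, ∃ z, b < z ∧
      Chain X H γ j y z := fun h b => by
    obtain ⟨c, hc⟩ := h.eventually_chain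
    obtain ⟨z, hz, hzH⟩ := hH (max b (max c _))
    rw [max_lt_iff, max_lt_iff] at hz
    exact ⟨z, hz.1, hc z hz.2.1.le hz.2.2 hzH⟩
  -- The first unboundedness statement to fail is located outside the model. Not all can hold, since
  -- a limit chain of length `n` would extend to a full chain.
  obtain ⟨j, hj, hj'⟩ : ∃ j, (∀ b, ∃ y, b < y ∧ LimChain X H γ j y) ∧
      ¬ ∀ b, ∃ y, b < y ∧ LimChain X H γ (j + 1) y := by
    by_contra! hcon
    have hall : ∀ j b, ∃ y, b < y ∧ LimChain X H γ j y := fun j => by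
      induction j with
      | zero => exact hH
      | succ j ih => exact hcon j ih
    obtain ⟨y, -, hy⟩ := hall n 0
    obtain ⟨z, -, hz⟩ := hlim hy 0
    exact hγ y z hz
  push Not at hj'
  obtain ⟨b, hb⟩ := hj'
  by_cases hγj : γ j
  · have hsettled : ∀ {x z : 𝓜.Num}, Chain X H γ j x z → x < z → b < z →
        ¬ ∃ z', Change X x z z' := fun {x z} h hxz hz hch =>
      hb z hz ⟨x, hxz, h, iff_of_true hch hγj⟩
    have htotal : ∀ u, ∃ z x, x < z ∧ u < x ∧ b < z ∧ Chain X H γ j x z := fun u => by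
      obtain ⟨x, hux, hx⟩ := hj u
      obtain ⟨z, hz, h⟩ := hlim hx (max b x)
      rw [max_lt_iff] at hz
      exact ⟨z, x, hz.2, hux, hz.1, h⟩
    have := @(defB_chain X H γ j).comp₂
    -- Membership of `u` can be read off from any settled pair `x < z` with `u < x`; asking some
    -- pair gives the `Σ⁰₁` form, asking all pairs the `Π⁰₁` form.
    obtain ⟨Y, hY⟩ := delta1_comprehension
      (fun z u => ∃ x, x < z ∧ u < x ∧ b < z ∧ Chain X H γ j x z ∧ ∃ t, t < z ∧ pair u t ∈ X)
      (fun z u => ∀ x, x < z → u < x → b < z → Chain X H γ j x z → ∃ t, t < z ∧ pair u t ∈ X)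
      fun u => by
        constructor
        · rintro ⟨z, x, hxz, hux, hbz, h, ht⟩ z' x' hxz' hux' hbz' h'
          rw [exists_iff_of_not_change (hsettled h' hxz' hbz') hux']
          rwa [exists_iff_of_not_change (hsettled h hxz hbz) hux] at ht
        · intro h
          obtain ⟨z, x, hxz, hux, hbz, hch⟩ := htotal u
          exact ⟨z, x, hxz, hux, hbz, hch, h z x hxz hux hbz hch⟩
    refine ⟨Y, fun u => (hY u).trans ?_⟩
    constructor
    · rintro ⟨z, x, hxz, hux, hbz, h, t, -, ht⟩
      exact ⟨t, ht⟩
    · intro ht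
      obtain ⟨z, x, hxz, hux, hbz, h⟩ := htotal u
      exact ⟨z, x, hxz, hux, hbz, h, (exists_iff_of_not_change (hsettled h hxz hbz) hux).2 ht⟩
  -- If `γ j` is false, a late enough `z` sees no further change below `y` and so extends the limit
  -- chain beyond `b`.
  · obtain ⟨y, -, hy⟩ := hj 0
    obtain ⟨c, hc⟩ := eventually_not_change X y
    obtain ⟨z, hz, h⟩ := hlim hy (max b (max c y))
    rw [max_lt_iff, max_lt_iff] at hz
    exact absurd ⟨y, hz.2.2, h, iff_of_false (hc z hz.2.1.le) hγj⟩ (hb z hz.1)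

/-! ### The colouring -/

open Classical in
/-- The number below `2 ^ n` with the binary digits `γ 0, …, γ (n - 1)`. -/
noncomputable def digits (γ : ℕ → Prop) : ℕ → 𝓜.Num
  | 0 => 0
  | n + 1 => 2 * digits γ n + if γ n then 1 else 0

theorem digits_congr {γ δ : ℕ → Prop} {n : ℕ} (h : ∀ i < n, (γ i ↔ δ i)) :
    (digits γ n : 𝓜.Num) = digits δ n := by
  induction n with
  | zero => rfl
  | succ n ih =>
    rw [digits, digits, ih fun i hi => h i (hi.trans (Nat.lt_succ_self n))]
    have hn := h n (Nat.lt_succ_self n)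
    by_cases hγ : γ n
    · rw [if_pos hγ, if_pos (hn.1 hγ)]
    · rw [if_neg hγ, if_neg (mt hn.2 hγ)]

theorem two_mul_add_one_lt {a b : 𝓜.Num} (h : a < b) : 2 * a + 1 < 2 * b := by
  have h' := mul_le_mul_of_nonneg_left (add_one_le_iff.2 h) (zero_le (2 : 𝓜.Num))
  refine lt_of_lt_of_le (lt_succ_self _) (le_trans (le_of_eq ?_) h')
  ring

theorem digits_lt (γ : ℕ → Prop) (n : ℕ) : (digits γ n : 𝓜.Num) < 2 ^ n := by
  induction n with
  | zero => simp [digits]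
  | succ n ih =>
    have h := two_mul_add_one_lt ih
    rw [pow_succ', digits]
    split_ifs
    · exact h
    · rw [add_zero]
      exact (lt_succ_self _).trans h

theorem even_or_odd (c : 𝓜.Num) : ∃ d, c = 2 * d ∨ c = 2 * d + 1 :=
  sigma1_induction (fun d c => c = 2 * d ∨ c = 2 * d + 1) ⟨0, .inl (mul_zero 2).symm⟩
    (fun c ⟨d, h⟩ => by
      rcases h with rfl | rfl
      · exact ⟨d, .inr rfl⟩
      · exact ⟨d + 1, .inl (by ring)⟩) c

/-- Turns an omitted colour into an omitted pattern, by splitting off the parity of `c`, which is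
the digit `γ (n - 1)`. -/
theorem exists_digits {n : ℕ} : ∀ {c : 𝓜.Num}, c < 2 ^ n → ∃ γ, digits γ n = c := by
  induction n with
  | zero =>
    intro c hc
    refine ⟨fun _ => True, ?_⟩
    rw [pow_zero, ← zero_add 1, lt_add_one_iff] at hc
    exact (le_antisymm hc (zero_le c)).symm
  | succ n ih =>
    intro c hc
    obtain ⟨d, hd⟩ := even_or_odd c
    have hlt : d < 2 ^ n := by
      by_contra! h
      have := mul_le_mul_of_nonneg_left h (zero_le (2 : 𝓜.Num))
      rw [← pow_succ'] at this
      refine hc.not_ge (this.trans ?_)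
      rcases hd with rfl | rfl
      exacts [le_rfl, le_self_add]
    obtain ⟨γ, hγ⟩ := ih hlt
    refine ⟨fun i => if i = n then c = 2 * d + 1 else γ i, ?_⟩
    rw [digits, digits_congr (δ := γ) fun i hi => by rw [if_neg hi.ne], hγ]
    simp only [if_true]
    rcases hd with rfl | rfl
    · rw [if_neg (lt_succ_self _).ne, add_zero]
    · rw [if_pos rfl]

/-- The code of a tuple. -/
def tuple (x : ℕ → 𝓜.Num) : ℕ → 𝓜.Num
  | 0 => 0
  | m + 1 => pair (tuple x m) (x m)

theorem tuple_inj {x y : ℕ → 𝓜.Num} {m : ℕ} :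
    tuple x m = tuple y m ↔ ∀ i < m, x i = y i := by
  induction m with
  | zero => exact iff_of_true rfl fun i hi => absurd hi (Nat.not_lt_zero i)
  | succ m ih => rw [tuple, tuple, pair_inj, ih, Nat.forall_lt_succ_right]

/-- The colour of the tuple `x 0, …, x (n + 1)`. -/
noncomputable def color (X : 𝓜.Sets) (n : ℕ) (x : ℕ → 𝓜.Num) : 𝓜.Num :=
  digits (fun i => Change X (x i) (x (i + 1)) (x (i + 2))) n

theorem color_congr (X : 𝓜.Sets) {n : ℕ} {x y : ℕ → 𝓜.Num} (h : ∀ i < n + 2, x i = y i) :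
    color X n x = color X n y :=
  digits_congr fun i hi => by
    rw [h i (by omega), h (i + 1) (by omega), h (i + 2) (by omega)]

/-- The graph of `color` on codes of increasing tuples. -/
def ColorRel (X : 𝓜.Sets) : ℕ → 𝓜.Num → 𝓜.Num → Prop
  | 0, w, c => ∃ x, x ≤ w ∧ ∃ y, y ≤ w ∧ w = pair (pair 0 x) y ∧ x < y ∧ c = 0
  | n + 1, w, c => ∃ p, p ≤ w ∧ ∃ x, x ≤ w ∧ ∃ y, y ≤ w ∧ ∃ z, z ≤ w ∧
      w = pair (pair (pair p x) y) z ∧ y < z ∧ ∃ d, d ≤ c ∧ ColorRel X n (pair (pair p x) y) d ∧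
        (Change X x y z ∧ c = 2 * d + 1 ∨ ¬ Change X x y z ∧ c = 2 * d)

theorem defB_colorRel (X : 𝓜.Sets) (n : ℕ) :
    DefB fun w : Fin 2 → 𝓜.Num => ColorRel X n (w 0) (w 1) := by
  induction n with
  | zero => unfold ColorRel; infer_instance
  | succ n ih =>
    have := @ih.comp₂
    unfold ColorRel
    infer_instance

/-- The bounds in `ColorRel` cost nothing: entries are at most the code of their tuple, and the
colour of an initial segment is at most the whole colour. -/
theorem colorRel_iff (X : 𝓜.Sets) (n : ℕ) : ∀ w c : 𝓜.Num, ColorRel X n w c ↔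
    ∃ x : ℕ → 𝓜.Num, w = tuple x (n + 2) ∧ (∀ i < n + 1, x i < x (i + 1)) ∧
      c = color X n x := by
  induction n with
  | zero =>
    intro w c
    constructor
    · rintro ⟨x, -, y, -, rfl, h, rfl⟩
      refine ⟨fun i => if i = 0 then x else y, rfl, fun i hi => ?_, rfl⟩
      obtain rfl : i = 0 := by omega
      exact h
    · rintro ⟨x, rfl, h, rfl⟩
      exact ⟨x 0, (le_pair_right _ _).trans (le_pair_left _ _), x 1, le_pair_right _ _, rfl,
        h 0 one_pos, rfl⟩
  | succ n ih =>
    intro w c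
    constructor
    · rintro ⟨p, -, a, -, b, -, z, -, rfl, hbz, d, -, hd, hc⟩
      obtain ⟨x, hp, hx, rfl⟩ := (ih _ _).1 hd
      rw [tuple, tuple, pair_inj, pair_inj] at hp
      obtain ⟨⟨rfl, rfl⟩, rfl⟩ := hp
      obtain ⟨x', hle, rfl⟩ : ∃ x' : ℕ → 𝓜.Num, (∀ i < n + 2, x' i = x i) ∧ x' (n + 2) = z :=
        ⟨fun i => if i < n + 2 then x i else z, fun i hi => if_pos hi, if_neg (by omega)⟩
      refine ⟨x', ?_, fun i hi => ?_, ?_⟩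
      · rw [tuple, tuple_inj.2 hle]
        rfl
      · rcases Nat.lt_succ_iff_lt_or_eq.1 hi with hi | rfl
        · rw [hle i (by omega), hle (i + 1) (by omega)]
          exact hx i hi
        · rwa [hle _ (by omega)]
      · have hcol := color_congr X hle
        unfold color at hcol hc ⊢
        rw [digits, hcol, hle n (by omega), hle (n + 1) (by omega)]
        rcases hc with ⟨h, rfl⟩ | ⟨h, rfl⟩
        · rw [if_pos h]
        · rw [if_neg h, add_zero]
    · rintro ⟨x, rfl, hx, rfl⟩
      refine ⟨tuple x n, ?_, x n, ?_, x (n + 1), ?_, x (n + 2), le_pair_right _ _, rfl,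
        hx _ (by omega), color X n x, ?_, (ih _ _).2 ⟨x, rfl, fun i hi => hx i (by omega), rfl⟩, ?_⟩
      · exact ((le_pair_left _ _).trans (le_pair_left _ _)).trans (le_pair_left _ _)
      · exact ((le_pair_right _ _).trans (le_pair_left _ _)).trans (le_pair_left _ _)
      · exact (le_pair_right _ _).trans (le_pair_left _ _)
      · unfold color
        rw [digits, two_mul, add_assoc]
        exact le_self_add
      · unfold color
        by_cases h : Change X (x n) (x (n + 1)) (x (n + 2))
        · exact .inl ⟨h, by rw [digits, if_pos h]⟩
        · exact .inr ⟨h, by rw [digits, if_neg h, add_zero]⟩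

theorem exists_coloring (X : 𝓜.Sets) (n : ℕ) : ∃ F : 𝓜.Sets, ∀ w, w ∈ F ↔
    ∃ x : ℕ → 𝓜.Num, (∀ i < n + 1, x i < x (i + 1)) ∧
      w = pair (tuple x (n + 2)) (color X n x) := by
  have := @(defB_colorRel X n).comp₂
  obtain ⟨F, hF⟩ := bounded_comprehension fun w : 𝓜.Num =>
    ∃ p, p ≤ w ∧ ∃ c, c ≤ w ∧ w = pair p c ∧ ColorRel X n p c
  refine ⟨F, fun w => (hF w).trans ⟨?_, ?_⟩⟩
  · rintro ⟨p, -, c, -, rfl, h⟩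
    obtain ⟨x, rfl, hx, rfl⟩ := (colorRel_iff X n p c).1 h
    exact ⟨x, hx, rfl⟩
  · rintro ⟨x, hx, rfl⟩
    exact ⟨_, le_pair_left _ _, _, le_pair_right _ _, rfl, (colorRel_iff X n _ _).2 ⟨x, rfl, hx, rfl⟩⟩

end Model

/-! ### The thin set principle in a model -/

section Sat

open Model

variable {v : ℕ → 𝓜.Num} {e : ℕ → 𝓜.Sets}

/-- Prepend the first `m` entries of `x` to an assignment. -/
def prepend {α : Type} (m : ℕ) (x v : ℕ → α) (i : ℕ) : α := if i < m then x i else v (i - m)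

theorem cons_prepend {α : Type} (m : ℕ) (a : α) (x v : ℕ → α) :
    cons a (prepend m x v) = prepend (m + 1) (cons a x) v := by
  funext i
  cases i <;> simp [prepend]

theorem cons_head_tail {α : Type} (x : ℕ → α) : (cons (x 0) fun i => x (i + 1)) = x := by
  funext i
  cases i <;> rfl

theorem prepend_of_lt {α : Type} {m i : ℕ} (x v : ℕ → α) (h : i < m) : prepend m x v i = x i :=
  if_pos h

theorem prepend_self {α : Type} (m : ℕ) (x v : ℕ → α) : prepend m x v m = v 0 := by
  simp [prepend]

/-- Only the first `m` entries of `x` matter, so whole sequences may be quantified over. -/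
theorem sat_allNs (m : ℕ) (φ : Form) : (allNs m φ).Sat 𝓜.toStruct v e ↔
    ∀ x : ℕ → 𝓜.Num, φ.Sat 𝓜.toStruct (prepend m x v) e := by
  induction m generalizing φ with
  | zero => exact ⟨fun h _ => h, fun h => h v⟩
  | succ m ih =>
    simp only [allNs, ih, sat_allN, cons_prepend]
    refine ⟨fun h x => ?_, fun h x a => h _⟩
    convert h (fun i => x (i + 1)) (x 0)
    exact (cons_head_tail x).symm

theorem sat_exNs (m : ℕ) (φ : Form) : (exNs m φ).Sat 𝓜.toStruct v e ↔
    ∃ x : ℕ → 𝓜.Num, φ.Sat 𝓜.toStruct (prepend m x v) e := by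
  induction m generalizing φ with
  | zero => exact ⟨fun h => ⟨v, h⟩, fun ⟨_, h⟩ => h⟩
  | succ m ih =>
    simp only [exNs, ih, sat_exN, cons_prepend]
    refine ⟨fun ⟨x, a, h⟩ => ⟨_, h⟩, fun ⟨x, h⟩ => ⟨fun i => x (i + 1), x 0, ?_⟩⟩
    convert h
    exact cons_head_tail x

theorem sat_conj (m : ℕ) (φ : ℕ → Form) : (conj φ m).Sat 𝓜.toStruct v e ↔
    ∀ i < m, (φ i).Sat 𝓜.toStruct v e := by
  induction m with
  | zero => simp [conj]
  | succ m ih => rw [conj, sat_and, ih, Nat.forall_lt_succ_right]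

theorem sat_increasing {τ : ℕ → Term} {x : ℕ → 𝓜.Num} {m : ℕ}
    (h : ∀ i < m, (τ i).eval 𝓜.toStruct v = x i) :
    (increasing τ m).Sat 𝓜.toStruct v e ↔ ∀ i < m - 1, x i < x (i + 1) := by
  rw [increasing, sat_conj]
  refine forall₂_congr fun i hi => ?_
  rw [sat_lt, h i (by omega), h (i + 1) (by omega)]
  rfl

theorem eval_tuple {τ : ℕ → Term} {x : ℕ → 𝓜.Num} {m : ℕ}
    (h : ∀ i < m, (τ i).eval 𝓜.toStruct v = x i) :
    (Term.tuple τ m).eval 𝓜.toStruct v = tuple x m := by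
  induction m with
  | zero => rfl
  | succ m ih =>
    simp only [Term.tuple, Term.pair, eval, ih fun i hi => h i (hi.trans (Nat.lt_succ_self m)),
      h m (Nat.lt_succ_self m)]
    rfl

theorem eval_pair (s t : Term) : (Term.pair s t).eval 𝓜.toStruct v =
    Model.pair (s.eval 𝓜.toStruct v) (t.eval 𝓜.toStruct v) := rfl

theorem eval_numeral (k : ℕ) : (numeral k).eval 𝓜.toStruct v = (k : 𝓜.Num) := by
  induction k with
  | zero => exact Nat.cast_zero.symm
  | succ k ih =>
    rw [Nat.cast_succ, ← ih]
    rfl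

theorem sat_isColoring (X : 𝓜.Sets) (n : ℕ) {F : ℕ} (hF : ∀ w, w ∈ e F ↔
    ∃ x : ℕ → 𝓜.Num, (∀ i < n + 1, x i < x (i + 1)) ∧
      w = Model.pair (tuple x (n + 2)) (color X n x)) :
    (isColoring (n + 2) (2 ^ n) F).Sat 𝓜.toStruct v e := by
  have hF' : ∀ w, 𝓜.mem w (e F) ↔ ∃ x : ℕ → 𝓜.Num, (∀ i < n + 1, x i < x (i + 1)) ∧
      w = Model.pair (tuple x (n + 2)) (color X n x) := hF
  have hlt : ∀ x : ℕ → 𝓜.Num, 𝓜.lt (color X n x) ((2 ^ n : ℕ) : 𝓜.Num) := fun x => by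
    rw [Nat.cast_pow, Nat.cast_ofNat]
    exact digits_lt _ n
  have h₀ : ∀ (x v : ℕ → 𝓜.Num), ∀ i < n + 2,
      (var i).eval 𝓜.toStruct (prepend (n + 2) x v) = x i :=
    fun x v i hi => prepend_of_lt x v hi
  have h₁ : ∀ (c : 𝓜.Num) (x v : ℕ → 𝓜.Num), ∀ i < n + 2,
      (var (i + 1)).eval 𝓜.toStruct (cons c (prepend (n + 2) x v)) = x i :=
    fun c x v i hi => prepend_of_lt x v hi
  have h₂ : ∀ (c d : 𝓜.Num) (x v : ℕ → 𝓜.Num), ∀ i < n + 2,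
      (var (i + 2)).eval 𝓜.toStruct (cons d (cons c (prepend (n + 2) x v))) = x i :=
    fun c d x v i hi => prepend_of_lt x v hi
  simp only [isColoring, sat_and, sat_allN, sat_imp, sat_mem, sat_exNs, sat_exN, sat_allNs, sat_lt,
    sat_eq, sat_increasing (h₀ _ _), sat_increasing (h₁ _ _ _), eval_pair, eval_tuple (h₁ _ _ _),
    eval_tuple (h₂ _ _ _ _), eval_numeral, Term.eval, cons_zero, cons_succ, prepend_self, hF']
  refine ⟨?_, fun x hx => ⟨_, hlt x, x, hx, rfl⟩, ?_⟩
  · rintro _ ⟨x, hx, rfl⟩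
    exact ⟨x, _, hx, hlt x, rfl⟩
  · rintro x c d ⟨⟨y, -, hy⟩, z, -, hz⟩
    obtain ⟨hxy, rfl⟩ := pair_inj.1 hy
    obtain ⟨hxz, rfl⟩ := pair_inj.1 hz
    rw [← color_congr X (tuple_inj.1 hxy), ← color_congr X (tuple_inj.1 hxz)]

theorem sigma1Comprehension_of_sat_TS (n : ℕ)
    (h : (TS (n + 2) (2 ^ n)).Sat 𝓜.toStruct v e) : 𝓜.Sigma1Comprehension := by
  intro X
  obtain ⟨F, hF⟩ := exists_coloring X n
  have hF' : ∀ w, 𝓜.mem w F ↔ ∃ x : ℕ → 𝓜.Num, (∀ i < n + 1, x i < x (i + 1)) ∧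
      w = Model.pair (tuple x (n + 2)) (color X n x) := hF
  rw [TS, sat_allS] at h
  obtain ⟨H, hH⟩ := sat_exS.1 (h F (sat_isColoring X n hF))
  have h₀ : ∀ (x v : ℕ → 𝓜.Num), ∀ i < n + 2,
      (var i).eval 𝓜.toStruct (prepend (n + 2) x v) = x i :=
    fun x v i hi => prepend_of_lt x v hi
  simp only [isInfinite, isThin, sat_and, sat_allN, sat_exN, sat_lt, sat_mem, sat_allNs, sat_imp,
    sat_neg, sat_conj, sat_increasing (h₀ _ _), eval_pair, eval_tuple (h₀ _ _), eval_numeral,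
    Term.eval, cons_zero, cons_one, prepend_self, hF'] at hH
  obtain ⟨hinf, c, hc, hthin⟩ := hH
  have hc' : c < 2 ^ n := by
    rw [Nat.cast_pow, Nat.cast_ofNat] at hc
    exact hc
  obtain ⟨γ, rfl⟩ := exists_digits hc'
  refine exists_sigma1_of_not_chain (γ := γ) (n := n) hinf fun y z hch => ?_
  obtain ⟨x, -, -, hx, hxH, hγ⟩ := hch.exists_tuple
  -- The entries of a full chain form a tuple in `H` with bits `γ`, that is, of the omitted colour.
  refine hthin x ⟨hx, fun i hi => ?_⟩ ⟨x, hx, ?_⟩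
  · rw [prepend_of_lt _ _ hi]
    exact hxH i hi
  · rw [color, digits_congr hγ]

end Sat

end SecondOrderArith

theorem mainTheorem11 (n : ℕ) (hn : 1 ≤ n) :
    ∀ χ ∈ SecondOrderArith.ACA, SecondOrderArith.Proves SecondOrderArith.RCA0
      (SecondOrderArith.Form.imp (SecondOrderArith.TS (n + 2) (2 ^ n)) χ) := by
  rintro _ ⟨φ, hφ, rfl⟩
  exact SecondOrderArith.proves_of_sat fun 𝓜 v e h =>
    (SecondOrderArith.sigma1Comprehension_of_sat_TS n h).sat_comprehensionAxiom hφ v e
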